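/- Let $q>1$ and $0<r<\frac q2$, put $q'=\frac{q}{q-1}$ and $f(u)=e^{u^q+u^r}$, and for $x\in\mathbb R^2$ near $0$, $x\ne 0$, let \[ w=w(x):=\frac{q'}{4}|x|^2\Bigl(\log\frac1{|x|^2}+1\Bigr). \] Then there exist $R>0$ and a radially symmetric singular solution $u\in C^\infty(B_R(0)\setminus\{0\})$ of $-\Delta u=f(u)$ in $B_R(0)\setminus\{0\}\subset\mathbb R^2$ (that is, $u\ge 0$, the equation holds classically in $B_R(0)\setminus\{0\}$, and $u(x)\to\infty$ as $|x|\to0$) such that, as $x\to 0$, \[ u(x)=\Biggl[-\log w-\biggl\{-\log w-\sum_{k=0}^{n-2}\Bigl(-\frac rq\Bigr)^k(-\log w)^{(k+1)\frac rq-k}-\frac{q-1}{q}\log(-\log w)\biggr\}^{\frac rq}-\frac{q-1}{q}\log(-\log w)+\log\frac1q\Biggr]^{\frac1q} +O\left(\frac1{(-\log w)^{2-\frac1q-\frac rq}}\right), \] where $n\ge2$ is the integer with $\frac1{1-r/q}<n\le\frac1{1-r/q}+1$. -/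

import Mathlib

open Filter Topology Asymptotics
open scoped ContDiff

/-- The Euclidean plane. -/
abbrev Plane : Type := EuclideanSpace ℝ (Fin 2)

/-- The open disc of radius `R` about the origin, with the origin removed. -/
def puncturedDisc (R : ℝ) : Set Plane := Metric.ball (0 : Plane) R \ {0}

/-- `u` is a (classical) singular solution of `-Δu = f(u)` in the punctured disc of radius `R`:
it is nonnegative and of class `C²` there, satisfies the equation pointwise there,
and tends to infinity at the origin. -/
structure IsSingularSolution (f : ℝ → ℝ) (R : ℝ) (u : Plane → ℝ) : Prop where
  contDiffOn : ContDiffOn ℝ 2 u (puncturedDisc R)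
  nonneg : ∀ x ∈ puncturedDisc R, 0 ≤ u x
  equation : ∀ x ∈ puncturedDisc R, -(Laplacian.laplacian u x) = f (u x)
  tendsto : Tendsto u (𝓝[≠] (0 : Plane)) atTop

/-- `w(x) = (q'/4) |x|² (log (1/|x|²) + 1)`, where `q' = q/(q-1)`. -/
noncomputable def wFun (q : ℝ) (x : Plane) : ℝ :=
  (q / (q - 1)) / 4 * ‖x‖ ^ 2 * (Real.log (1 / ‖x‖ ^ 2) + 1)

/-- The expansion as a function of `L = -log w`:
`[L - {L - ∑_{k=0}^{n-2} (-r/q)^k L^{(k+1)r/q-k} - ((q-1)/q) log L}^{r/q}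
  - ((q-1)/q) log L + log (1/q)]^{1/q}`. -/
noncomputable def expansion (q r : ℝ) (n : ℕ) (L : ℝ) : ℝ :=
  (L
    - (L - ∑ k ∈ Finset.range (n - 1), (-(r / q)) ^ k * L ^ (((k : ℝ) + 1) * (r / q) - (k : ℝ))
        - (q - 1) / q * Real.log L) ^ (r / q)
    - (q - 1) / q * Real.log L + Real.log (1 / q)) ^ (1 / q)

/-!
In the variable `τ = -log |x|²` a radial solution `u(x) = v(τ)` satisfies
`v'' = -exp(v^q + v^r - τ) / 4`. Balancing both sides with `v ≈ τ^(1/q)` shows that `τ` is close to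
`v^q + v^r + (2q-1) log v - log (4(q-1)/q²)`; two further terms, of orders `v^(r-q)` and `v^(-q)`,
turn this into an explicit function `T(v)` whose inverse `X` solves the equation up to a relative
error of the square of `v^(r-q)`.

Linearizing at `X` gives `φ'' = -(κ/τ) φ + …` with `κ = (q-1)/q`, whose solutions oscillate with
amplitude `τ^(1/4)`. Up to a term of order `τ^(-2)` a fundamental pair is explicit, and integrating
the variation of constants formula from infinity makes the correction problem for `φ = v - X` a
contraction in a tube in which `φ = O(X^(r-2q+1))`; this uses `r < q/2`.

Finally `v^q + v^r = L - κ log L - log q + O(L^(r/q-1))` with `L = -log w`, and this relation is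
solved for `v^q` by two substitutions. As `r/q < 1/2`, the integer `n` of the statement is `2`.
-/

section TailIntegral

open MeasureTheory Set

variable {F : Type*} [NormedAddCommGroup F] {G : ℝ → F} {a t C δ : ℝ}

theorem hasDerivAt_integral_Ioi [NormedSpace ℝ F] [CompleteSpace F] (hint : IntegrableOn G (Ioi a))
    (hG : ContinuousOn G (Ioi a)) (ht : a < t) :
    HasDerivAt (fun s => ∫ x in Ioi s, G x) (-G t) t := by
  obtain ⟨b, hab, hbt⟩ := exists_between ht
  have hb : IntegrableOn G (Ioi b) := hint.mono_set (Ioi_subset_Ioi hab.le)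
  have hderiv : HasDerivAt (fun s => (∫ x in Ioi b, G x) - ∫ x in b..s, G x) (-G t) t := by
    refine HasDerivAt.const_sub _ (intervalIntegral.integral_hasDerivAt_right ?_
      (hG.stronglyMeasurableAtFilter isOpen_Ioi t ht) (hG.continuousAt (Ioi_mem_nhds ht)))
    exact (hG.mono fun x hx => hab.trans_le (uIcc_of_le hbt.le ▸ hx).1).intervalIntegrable
  refine hderiv.congr_of_eventuallyEq ?_
  filter_upwards [Ioi_mem_nhds hbt] with s hs
  rw [← intervalIntegral.integral_Ioi_sub_Ioi hb (le_of_lt hs), sub_sub_cancel]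

theorem integrableOn_Ioi_of_norm_le_rpow (ha : 0 < a) (hδ : 0 < δ) (hG : ContinuousOn G (Ioi a))
    (hC : ∀ t, a < t → ‖G t‖ ≤ C * t ^ (-1 - δ)) : IntegrableOn G (Ioi a) :=
  ((integrableOn_Ioi_rpow_of_lt (by linarith) ha).const_mul C).mono'
    (hG.aestronglyMeasurable measurableSet_Ioi)
    ((ae_restrict_iff' measurableSet_Ioi).2 (ae_of_all _ hC))

theorem norm_integral_Ioi_le_of_norm_le_rpow [NormedSpace ℝ F] (ha : 0 < a) (hδ : 0 < δ)
    (hC : ∀ t, a < t → ‖G t‖ ≤ C * t ^ (-1 - δ)) :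
    ‖∫ s in Ioi a, G s‖ ≤ C / δ * a ^ (-δ) := by
  have hpow : ∫ s in Ioi a, s ^ (-1 - δ) = a ^ (-δ) / δ := by
    rw [integral_Ioi_rpow_of_lt (by linarith) ha, show -1 - δ + 1 = -δ by ring, neg_div_neg_eq]
  calc ‖∫ s in Ioi a, G s‖ ≤ ∫ s in Ioi a, C * s ^ (-1 - δ) :=
        norm_integral_le_of_norm_le ((integrableOn_Ioi_rpow_of_lt (by linarith) ha).const_mul C)
          ((ae_restrict_iff' measurableSet_Ioi).2 (ae_of_all _ hC))
    _ = C / δ * a ^ (-δ) := by rw [integral_const_mul, hpow]; ring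

end TailIntegral

/-- Two solutions `φ₁`, `φ₂` of `y'' = Q y` on `(0, ∞)` with nonzero Wronskian `W`, both growing at
most like `t ^ m`. The derivatives are recorded as the separate functions `φ₁'`, `φ₂'`. -/
structure FundamentalPair (Q : ℝ → ℝ) (m : ℝ) where
  (φ₁ φ₂ φ₁' φ₂' : ℝ → ℝ)
  W : ℝ
  W_ne_zero : W ≠ 0
  wronskian_eq : ∀ t, 0 < t → φ₁ t * φ₂' t - φ₁' t * φ₂ t = W
  hasDerivAt₁ : ∀ t, 0 < t → HasDerivAt φ₁ (φ₁' t) t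
  hasDerivAt₂ : ∀ t, 0 < t → HasDerivAt φ₂ (φ₂' t) t
  hasDerivAt₁' : ∀ t, 0 < t → HasDerivAt φ₁' (Q t * φ₁ t) t
  hasDerivAt₂' : ∀ t, 0 < t → HasDerivAt φ₂' (Q t * φ₂ t) t
  abs_le₁ : ∀ t, 0 < t → |φ₁ t| ≤ t ^ m
  abs_le₂ : ∀ t, 0 < t → |φ₂ t| ≤ t ^ m

namespace FundamentalPair

open MeasureTheory Set

variable {Q g g₁ g₂ φ : ℝ → ℝ} {m t₀ t D D₁ D₂ δ : ℝ} (P : FundamentalPair Q m)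

/-- Variation of constants from infinity: the solution of `y'' = Q y + g` that decays relative to
the fundamental pair. -/
noncomputable def solution (g : ℝ → ℝ) (t : ℝ) : ℝ :=
  P.W⁻¹ * (P.φ₁ t * (∫ s in Ioi t, P.φ₂ s * g s) - P.φ₂ t * ∫ s in Ioi t, P.φ₁ s * g s)

/-- The derivative of `FundamentalPair.solution`. -/
noncomputable def solutionDeriv (g : ℝ → ℝ) (t : ℝ) : ℝ :=
  P.W⁻¹ * (P.φ₁' t * (∫ s in Ioi t, P.φ₂ s * g s) - P.φ₂' t * ∫ s in Ioi t, P.φ₁ s * g s)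

theorem continuousOn₁ : ContinuousOn P.φ₁ (Ioi 0) := fun t ht =>
  (P.hasDerivAt₁ t ht).continuousAt.continuousWithinAt

theorem continuousOn₂ : ContinuousOn P.φ₂ (Ioi 0) := fun t ht =>
  (P.hasDerivAt₂ t ht).continuousAt.continuousWithinAt

theorem abs_mul_le_rpow (ht : 0 < t) (hφ : |φ t| ≤ t ^ m) (hg : |g t| ≤ D * t ^ (-1 - m - δ)) :
    |φ t * g t| ≤ D * t ^ (-1 - δ) := by
  have hsplit : t ^ (-1 - δ) = t ^ m * t ^ (-1 - m - δ) := by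
    rw [← Real.rpow_add ht]; congr 1; ring
  calc |φ t * g t| = |φ t| * |g t| := abs_mul _ _
    _ ≤ t ^ m * (D * t ^ (-1 - m - δ)) := by gcongr
    _ = D * t ^ (-1 - δ) := by rw [hsplit]; ring

theorem integrableOn_mul (ht₀ : 0 < t₀) (hδ : 0 < δ) (hφc : ContinuousOn φ (Ioi 0))
    (hφ : ∀ t, 0 < t → |φ t| ≤ t ^ m) (hg : ContinuousOn g (Ioi t₀))
    (hgD : ∀ t, t₀ < t → |g t| ≤ D * t ^ (-1 - m - δ)) :
    IntegrableOn (fun s => φ s * g s) (Ioi t₀) :=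
  integrableOn_Ioi_of_norm_le_rpow ht₀ hδ ((hφc.mono (Ioi_subset_Ioi ht₀.le)).mul hg)
    fun t ht => abs_mul_le_rpow (ht₀.trans ht) (hφ t (ht₀.trans ht)) (hgD t ht)

theorem abs_integral_mul_le (ht : 0 < t) (hδ : 0 < δ) (hφ : ∀ t, 0 < t → |φ t| ≤ t ^ m)
    (hgD : ∀ s, t < s → |g s| ≤ D * s ^ (-1 - m - δ)) :
    |∫ s in Ioi t, φ s * g s| ≤ D / δ * t ^ (-δ) := by
  rw [← Real.norm_eq_abs]
  exact norm_integral_Ioi_le_of_norm_le_rpow ht hδ fun s hs =>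
    abs_mul_le_rpow (ht.trans hs) (hφ s (ht.trans hs)) (hgD s hs)

theorem abs_solution_le (ht : 0 < t) (hδ : 0 < δ)
    (hgD : ∀ s, t < s → |g s| ≤ D * s ^ (-1 - m - δ)) :
    |P.solution g t| ≤ 2 * D / (δ * |P.W|) * t ^ (m - δ) := by
  have hW : 0 < |P.W| := abs_pos.2 P.W_ne_zero
  calc |P.solution g t|
      = |P.W|⁻¹ * |P.φ₁ t * (∫ s in Ioi t, P.φ₂ s * g s)
          - P.φ₂ t * ∫ s in Ioi t, P.φ₁ s * g s| := by rw [solution, abs_mul, abs_inv]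
    _ ≤ |P.W|⁻¹ * (|P.φ₁ t| * |∫ s in Ioi t, P.φ₂ s * g s|
          + |P.φ₂ t| * |∫ s in Ioi t, P.φ₁ s * g s|) := by
        gcongr
        exact (abs_sub _ _).trans_eq (by rw [abs_mul, abs_mul])
    _ ≤ |P.W|⁻¹ * (t ^ m * (D / δ * t ^ (-δ)) + t ^ m * (D / δ * t ^ (-δ))) := by
        gcongr
        exacts [P.abs_le₁ t ht, abs_integral_mul_le ht hδ P.abs_le₂ hgD, P.abs_le₂ t ht,
          abs_integral_mul_le ht hδ P.abs_le₁ hgD]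
    _ = 2 * D / (δ * |P.W|) * t ^ (m - δ) := by
        rw [sub_eq_add_neg, Real.rpow_add ht]
        field_simp
        ring

theorem hasDerivAt_solution (ht₀ : 0 < t₀) (hδ : 0 < δ) (hg : ContinuousOn g (Ioi t₀))
    (hgD : ∀ t, t₀ < t → |g t| ≤ D * t ^ (-1 - m - δ)) (ht : t₀ < t) :
    HasDerivAt (P.solution g) (P.solutionDeriv g t) t := by
  have hmono : Ioi t₀ ⊆ Ioi 0 := Ioi_subset_Ioi ht₀.le
  have hI₁ := hasDerivAt_integral_Ioi (integrableOn_mul ht₀ hδ P.continuousOn₁ P.abs_le₁ hg hgD)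
    ((P.continuousOn₁.mono hmono).mul hg) ht
  have hI₂ := hasDerivAt_integral_Ioi (integrableOn_mul ht₀ hδ P.continuousOn₂ P.abs_le₂ hg hgD)
    ((P.continuousOn₂.mono hmono).mul hg) ht
  refine ((((P.hasDerivAt₁ t (ht₀.trans ht)).mul hI₂).sub
    ((P.hasDerivAt₂ t (ht₀.trans ht)).mul hI₁)).const_mul P.W⁻¹).congr_deriv ?_
  rw [solutionDeriv]
  ring

theorem hasDerivAt_solutionDeriv (ht₀ : 0 < t₀) (hδ : 0 < δ) (hg : ContinuousOn g (Ioi t₀))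
    (hgD : ∀ t, t₀ < t → |g t| ≤ D * t ^ (-1 - m - δ)) (ht : t₀ < t) :
    HasDerivAt (P.solutionDeriv g) (Q t * P.solution g t + g t) t := by
  have hmono : Ioi t₀ ⊆ Ioi 0 := Ioi_subset_Ioi ht₀.le
  have hI₁ := hasDerivAt_integral_Ioi (integrableOn_mul ht₀ hδ P.continuousOn₁ P.abs_le₁ hg hgD)
    ((P.continuousOn₁.mono hmono).mul hg) ht
  have hI₂ := hasDerivAt_integral_Ioi (integrableOn_mul ht₀ hδ P.continuousOn₂ P.abs_le₂ hg hgD)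
    ((P.continuousOn₂.mono hmono).mul hg) ht
  refine ((((P.hasDerivAt₁' t (ht₀.trans ht)).mul hI₂).sub
    ((P.hasDerivAt₂' t (ht₀.trans ht)).mul hI₁)).const_mul P.W⁻¹).congr_deriv ?_
  have hg_eq : P.W⁻¹ * ((P.φ₁ t * P.φ₂' t - P.φ₁' t * P.φ₂ t) * g t) = g t := by
    rw [P.wronskian_eq t (ht₀.trans ht), inv_mul_cancel_left₀ P.W_ne_zero]
  rw [solution]
  linear_combination hg_eq

theorem solution_sub (ht₀ : 0 < t₀) (hδ : 0 < δ)
    (hg₁ : ContinuousOn g₁ (Ioi t₀)) (hgD₁ : ∀ t, t₀ < t → |g₁ t| ≤ D₁ * t ^ (-1 - m - δ))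
    (hg₂ : ContinuousOn g₂ (Ioi t₀)) (hgD₂ : ∀ t, t₀ < t → |g₂ t| ≤ D₂ * t ^ (-1 - m - δ))
    (ht : t₀ ≤ t) :
    P.solution (fun s => g₁ s - g₂ s) t = P.solution g₁ t - P.solution g₂ t := by
  have hmono : Ioi t ⊆ Ioi t₀ := Ioi_subset_Ioi ht
  have hint₁ {g D} (hg : ContinuousOn g (Ioi t₀)) (hgD : ∀ t, t₀ < t → |g t| ≤ D * _) :=
    (integrableOn_mul ht₀ hδ P.continuousOn₁ P.abs_le₁ hg hgD).mono_set hmono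
  have hint₂ {g D} (hg : ContinuousOn g (Ioi t₀)) (hgD : ∀ t, t₀ < t → |g t| ≤ D * _) :=
    (integrableOn_mul ht₀ hδ P.continuousOn₂ P.abs_le₂ hg hgD).mono_set hmono
  simp only [solution, mul_sub]
  rw [integral_sub (hint₁ hg₁ hgD₁) (hint₁ hg₂ hgD₂),
    integral_sub (hint₂ hg₁ hgD₁) (hint₂ hg₂ hgD₂)]
  ring

end FundamentalPair

/-- The nonlinearity `N t y` is a small perturbation on the tube `|y| ≤ t ^ e`, `t > t₀`: it is
continuous, of size `t ^ (e - β)` at `y = 0`, and Lipschitz in `y` with constant `B * t ^ (-β)`. -/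
structure IsTubePerturbation (N : ℝ → ℝ → ℝ) (t₀ B e β : ℝ) : Prop where
  pos : 0 < t₀
  continuousOn : ContinuousOn (Function.uncurry N) {p | t₀ < p.1 ∧ |p.2| ≤ p.1 ^ e}
  abs_zero_le : ∀ t, t₀ < t → |N t 0| ≤ B * t ^ (e - β)
  abs_sub_le : ∀ t, t₀ < t → ∀ x y, |x| ≤ t ^ e → |y| ≤ t ^ e →
    |N t x - N t y| ≤ B * t ^ (-β) * |x - y|

/-- The forcing term produced by the perturbation `N` along the curve `t ^ e * χ t`; the values
`|χ| ≤ 1` parametrize the curves inside the tube. -/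
noncomputable def tubeForcing (N : ℝ → ℝ → ℝ) (e : ℝ) (χ : ℝ → ℝ) (t : ℝ) : ℝ :=
  N t (t ^ e * χ t)

namespace IsTubePerturbation

open Set
open scoped BoundedContinuousFunction

variable {N : ℝ → ℝ → ℝ} {χ χ₁ χ₂ : ℝ → ℝ} {t₀ B e β d t : ℝ}

theorem abs_rpow_mul_le (ht : 0 < t) {y : ℝ} (hy : |y| ≤ d) : |t ^ e * y| ≤ t ^ e * d := by
  rw [abs_mul, abs_of_pos (Real.rpow_pos_of_pos ht e)]
  gcongr

theorem nonneg (hN : IsTubePerturbation N t₀ B e β) : 0 ≤ B := by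
  have ht : 0 < t₀ + 1 := by linarith [hN.pos]
  have h := (abs_nonneg _).trans (hN.abs_zero_le (t₀ + 1) (lt_add_one _))
  exact nonneg_of_mul_nonneg_left h (Real.rpow_pos_of_pos ht _)

theorem continuousOn_tubeForcing (hN : IsTubePerturbation N t₀ B e β) (hχ : Continuous χ)
    (hχ1 : ∀ t, |χ t| ≤ 1) : ContinuousOn (tubeForcing N e χ) (Ioi t₀) := by
  refine hN.continuousOn.comp (f := fun t => (t, t ^ e * χ t)) (continuousOn_id.prodMk ?_)
    fun t ht => ⟨ht, by simpa only [mul_one] using abs_rpow_mul_le (hN.pos.trans ht) (hχ1 t)⟩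
  exact (continuousOn_id.rpow_const fun t ht => Or.inl (hN.pos.trans ht).ne').mul hχ.continuousOn

theorem abs_tubeForcing_sub_le (hN : IsTubePerturbation N t₀ B e β) (hχ₁ : ∀ t, |χ₁ t| ≤ 1)
    (hχ₂ : ∀ t, |χ₂ t| ≤ 1) (hd : ∀ t, |χ₁ t - χ₂ t| ≤ d) (ht : t₀ < t) :
    |tubeForcing N e χ₁ t - tubeForcing N e χ₂ t| ≤ B * d * t ^ (e - β) := by
  have ht0 : 0 < t := hN.pos.trans ht
  have hB := hN.nonneg
  have htube {y : ℝ} (hy : |y| ≤ 1) : |t ^ e * y| ≤ t ^ e := by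
    simpa only [mul_one] using abs_rpow_mul_le ht0 hy
  calc |tubeForcing N e χ₁ t - tubeForcing N e χ₂ t|
      ≤ B * t ^ (-β) * |t ^ e * χ₁ t - t ^ e * χ₂ t| :=
        hN.abs_sub_le t ht _ _ (htube (hχ₁ t)) (htube (hχ₂ t))
    _ ≤ B * t ^ (-β) * (t ^ e * d) := by
        rw [← mul_sub]
        gcongr
        exact abs_rpow_mul_le ht0 (hd t)
    _ = B * d * t ^ (e - β) := by rw [sub_eq_add_neg, Real.rpow_add ht0]; ring

theorem abs_tubeForcing_le (hN : IsTubePerturbation N t₀ B e β) (hχ : ∀ t, |χ t| ≤ 1)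
    (ht : t₀ < t) : |tubeForcing N e χ t| ≤ 2 * B * t ^ (e - β) := by
  have hsub := hN.abs_tubeForcing_sub_le (χ₂ := 0) (d := 1) hχ (by simp) (by simpa using hχ) ht
  have hzero : |tubeForcing N e 0 t| ≤ B * t ^ (e - β) := by
    simpa [tubeForcing] using hN.abs_zero_le t ht
  calc |tubeForcing N e χ t|
      ≤ |tubeForcing N e χ t - tubeForcing N e 0 t| + |tubeForcing N e 0 t| :=
        by simpa using abs_add_le (tubeForcing N e χ t - tubeForcing N e 0 t) (tubeForcing N e 0 t)
    _ ≤ B * 1 * t ^ (e - β) + B * t ^ (e - β) := add_le_add hsub hzero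
    _ = 2 * B * t ^ (e - β) := by ring

end IsTubePerturbation

namespace FundamentalPair

open Set
open scoped BoundedContinuousFunction

variable {N : ℝ → ℝ → ℝ} {Q g χ χ₁ χ₂ : ℝ → ℝ} {m t₀ t₁ B D e ε d t : ℝ} (P : FundamentalPair Q m)

theorem abs_rpow_mul_solution_le (ht : 0 < t) (he : e < m + ε)
    (hgD : ∀ s, t < s → |g s| ≤ D * s ^ (e - (1 + 2 * m + ε))) :
    |t ^ (-e) * P.solution g t| ≤ 2 * D / ((m + ε - e) * |P.W|) * t ^ (-ε) := by
  have hsol := P.abs_solution_le ht (δ := m + ε - e) (sub_pos.2 he) (D := D) fun s hs => by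
    convert hgD s hs using 3; ring
  calc |t ^ (-e) * P.solution g t| = t ^ (-e) * |P.solution g t| := by
        rw [abs_mul, abs_of_pos (Real.rpow_pos_of_pos ht _)]
    _ ≤ t ^ (-e) * (2 * D / ((m + ε - e) * |P.W|) * t ^ (m - (m + ε - e))) := by gcongr
    _ = 2 * D / ((m + ε - e) * |P.W|) * t ^ (-ε) := by
        rw [mul_left_comm, ← Real.rpow_add ht]; congr 2; ring

/-- The Picard map, in the weighted unknown `χ = t ^ (-e) * y`, of the equation
`y'' = Q y + N t y`. Times below `t₁` are replaced by `t₁`, so that the map acts on bounded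
continuous functions on the whole line. -/
noncomputable def tubePicard (N : ℝ → ℝ → ℝ) (e t₁ : ℝ) (χ : ℝ → ℝ) (t : ℝ) : ℝ :=
  max t t₁ ^ (-e) * P.solution (tubeForcing N e χ) (max t t₁)

section

variable (hN : IsTubePerturbation N t₀ B e (1 + 2 * m + ε)) (he : e < m + ε)

include hN he

theorem hasDerivAt_solution_tubeForcing (hχ : Continuous χ) (hχ1 : ∀ t, |χ t| ≤ 1) (ht : t₀ < t) :
    HasDerivAt (P.solution (tubeForcing N e χ)) (P.solutionDeriv (tubeForcing N e χ) t) t :=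
  P.hasDerivAt_solution hN.pos (sub_pos.2 he) (hN.continuousOn_tubeForcing hχ hχ1)
    (fun s hs => by convert hN.abs_tubeForcing_le hχ1 hs using 3; ring) ht

theorem hasDerivAt_solutionDeriv_tubeForcing (hχ : Continuous χ) (hχ1 : ∀ t, |χ t| ≤ 1)
    (ht : t₀ < t) :
    HasDerivAt (P.solutionDeriv (tubeForcing N e χ))
      (Q t * P.solution (tubeForcing N e χ) t + tubeForcing N e χ t) t :=
  P.hasDerivAt_solutionDeriv hN.pos (sub_pos.2 he) (hN.continuousOn_tubeForcing hχ hχ1)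
    (fun s hs => by convert hN.abs_tubeForcing_le hχ1 hs using 3; ring) ht

theorem continuous_tubePicard (ht₁ : t₀ < t₁) (hχ : Continuous χ) (hχ1 : ∀ t, |χ t| ≤ 1) :
    Continuous (P.tubePicard N e t₁ χ) := by
  have hmax (t : ℝ) : t₀ < max t t₁ := ht₁.trans_le (le_max_right _ _)
  have hcont : Continuous fun t : ℝ => max t t₁ := continuous_id.max continuous_const
  refine (hcont.rpow_const fun t => Or.inl (hN.pos.trans (hmax t)).ne').mul
    (continuous_iff_continuousAt.2 fun t => ?_)
  exact ContinuousAt.comp (f := fun t : ℝ => max t t₁)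
    (P.hasDerivAt_solution_tubeForcing hN he hχ hχ1 (hmax t)).continuousAt hcont.continuousAt

theorem abs_tubePicard_le (ht₁ : t₀ < t₁)
    (hsmall : ∀ t, t₁ ≤ t → 4 * B / ((m + ε - e) * |P.W|) * t ^ (-ε) ≤ 1)
    (hχ1 : ∀ t, |χ t| ≤ 1) (t : ℝ) : |P.tubePicard N e t₁ χ t| ≤ 1 := by
  have hmax : t₀ < max t t₁ := ht₁.trans_le (le_max_right _ _)
  refine (P.abs_rpow_mul_solution_le (D := 2 * B) (hN.pos.trans hmax) he
    fun s hs => hN.abs_tubeForcing_le hχ1 (hmax.trans hs)).trans ?_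
  rw [show 2 * (2 * B) = 4 * B by ring]
  exact hsmall _ (le_max_right t t₁)

theorem abs_tubePicard_sub_le (ht₁ : t₀ < t₁)
    (hsmall : ∀ t, t₁ ≤ t → 4 * B / ((m + ε - e) * |P.W|) * t ^ (-ε) ≤ 1)
    (hχ₁ : Continuous χ₁) (hχ₁1 : ∀ t, |χ₁ t| ≤ 1) (hχ₂ : Continuous χ₂)
    (hχ₂1 : ∀ t, |χ₂ t| ≤ 1) (hd : ∀ t, |χ₁ t - χ₂ t| ≤ d) (t : ℝ) :
    |P.tubePicard N e t₁ χ₁ t - P.tubePicard N e t₁ χ₂ t| ≤ d / 2 := by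
  have hmax : t₀ < max t t₁ := ht₁.trans_le (le_max_right _ _)
  have hd0 : 0 ≤ d := (abs_nonneg _).trans (hd 0)
  have hbound {χ : ℝ → ℝ} (hχ1 : ∀ t, |χ t| ≤ 1) (s : ℝ) (hs : t₀ < s) :
      |tubeForcing N e χ s| ≤ 2 * B * s ^ (-1 - m - (m + ε - e)) := by
    convert hN.abs_tubeForcing_le hχ1 hs using 3; ring
  rw [tubePicard, tubePicard, ← mul_sub, ← P.solution_sub hN.pos (sub_pos.2 he)
    (hN.continuousOn_tubeForcing hχ₁ hχ₁1) (hbound hχ₁1)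
    (hN.continuousOn_tubeForcing hχ₂ hχ₂1) (hbound hχ₂1) hmax.le]
  calc |max t t₁ ^ (-e) * P.solution (fun s => tubeForcing N e χ₁ s - tubeForcing N e χ₂ s)
          (max t t₁)|
      ≤ 2 * (B * d) / ((m + ε - e) * |P.W|) * max t t₁ ^ (-ε) :=
        P.abs_rpow_mul_solution_le (hN.pos.trans hmax) he
          fun s hs => hN.abs_tubeForcing_sub_le hχ₁1 hχ₂1 hd (hmax.trans hs)
    _ = 4 * B / ((m + ε - e) * |P.W|) * max t t₁ ^ (-ε) * (d / 2) := by ring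
    _ ≤ d / 2 := mul_le_of_le_one_left (by positivity) (hsmall _ (le_max_right t t₁))

theorem exists_tubePicard_eq_self (ht₁ : t₀ < t₁)
    (hsmall : ∀ t, t₁ ≤ t → 4 * B / ((m + ε - e) * |P.W|) * t ^ (-ε) ≤ 1) :
    ∃ χ : ℝ → ℝ, Continuous χ ∧ (∀ t, |χ t| ≤ 1) ∧ P.tubePicard N e t₁ χ = χ := by
  let ball : Set (ℝ →ᵇ ℝ) := Metric.closedBall 0 1
  have hball {χ : ℝ →ᵇ ℝ} : χ ∈ ball ↔ ∀ t, |χ t| ≤ 1 := by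
    simp [ball, BoundedContinuousFunction.norm_le zero_le_one]
  have : CompleteSpace ball := Metric.isClosed_closedBall.completeSpace_coe
  have : Nonempty ball := ⟨0, by simp [ball]⟩
  let picard (χ : ball) : ball :=
    ⟨BoundedContinuousFunction.ofNormedAddCommGroup _
        (P.continuous_tubePicard hN he ht₁ χ.1.continuous (hball.1 χ.2)) 1
        (P.abs_tubePicard_le hN he ht₁ hsmall (hball.1 χ.2)),
      hball.2 (P.abs_tubePicard_le hN he ht₁ hsmall (hball.1 χ.2))⟩
  have hcontr : ContractingWith (1 / 2) picard := by
    refine ⟨by norm_num, LipschitzWith.of_dist_le_mul fun χ₁ χ₂ => ?_⟩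
    refine (BoundedContinuousFunction.dist_le (by positivity)).2 fun t => ?_
    have hsub := P.abs_tubePicard_sub_le hN he ht₁ hsmall χ₁.1.continuous (hball.1 χ₁.2)
      χ₂.1.continuous (hball.1 χ₂.2) (BoundedContinuousFunction.dist_coe_le_dist (f := χ₁.1)) t
    have hrate : ((1 / 2 : NNReal) : ℝ) * dist χ₁ χ₂ = dist χ₁.1 χ₂.1 / 2 := by
      rw [Subtype.dist_eq, NNReal.coe_div, NNReal.coe_one, NNReal.coe_ofNat]
      ring
    rwa [hrate]
  refine ⟨hcontr.fixedPoint.1, hcontr.fixedPoint.1.continuous, hball.1 hcontr.fixedPoint.2, ?_⟩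
  exact congrArg (fun χ : ball => (χ.1 : ℝ → ℝ)) hcontr.fixedPoint_isFixedPt

end

theorem exists_solution_in_tube (P : FundamentalPair Q m)
    (hN : IsTubePerturbation N t₀ B e (1 + 2 * m + ε)) (he : e < m + ε) (hε : 0 < ε) :
    ∃ t₁, t₀ < t₁ ∧ ∃ φ φ' : ℝ → ℝ, ∀ t, t₁ < t → |φ t| ≤ t ^ e ∧ HasDerivAt φ (φ' t) t ∧
      HasDerivAt φ' (Q t * φ t + N t (φ t)) t := by
  obtain ⟨t₁, ht₁, hsmall⟩ : ∃ t₁, t₀ < t₁ ∧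
      ∀ t, t₁ ≤ t → 4 * B / ((m + ε - e) * |P.W|) * t ^ (-ε) ≤ 1 := by
    have hlim := (tendsto_rpow_neg_atTop hε).const_mul (4 * B / ((m + ε - e) * |P.W|))
    rw [mul_zero] at hlim
    obtain ⟨T, hT⟩ := eventually_atTop.1 (hlim.eventually_le_const zero_lt_one)
    exact ⟨max (t₀ + 1) T, by simp, fun t ht => hT t ((le_max_right _ _).trans ht)⟩
  obtain ⟨χ, hχ, hχ1, hfix⟩ := P.exists_tubePicard_eq_self hN he ht₁ hsmall
  refine ⟨t₁, ht₁, P.solution (tubeForcing N e χ), P.solutionDeriv (tubeForcing N e χ),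
    fun t ht => ?_⟩
  have ht0 : 0 < t := hN.pos.trans (ht₁.trans ht)
  have hsol : P.solution (tubeForcing N e χ) t = t ^ e * χ t := by
    rw [← hfix, tubePicard, max_eq_left ht.le, ← mul_assoc, ← Real.rpow_add ht0, add_neg_cancel,
      Real.rpow_zero, one_mul, hfix]
  refine ⟨?_, P.hasDerivAt_solution_tubeForcing hN he hχ hχ1 (ht₁.trans ht), ?_⟩
  · simpa only [hsol, mul_one] using IsTubePerturbation.abs_rpow_mul_le ht0 (hχ1 t)
  · simpa only [hsol, tubeForcing]
      using P.hasDerivAt_solutionDeriv_tubeForcing hN he hχ hχ1 (ht₁.trans ht)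

end FundamentalPair

section Oscillator

variable {κ α t : ℝ}

/-- The phase `2 √(κ t) + α` of the WKB solutions of `y'' = -(κ / t) y`. -/
noncomputable def oscillatorPhase (κ α t : ℝ) : ℝ := 2 * √κ * √t + α

/-- The WKB approximation `t ^ (1 / 4) * cos (2 √(κ t) + α)` to the solutions of
`y'' = -(κ / t) y`. -/
noncomputable def oscillator (κ α t : ℝ) : ℝ := t ^ (1 / 4 : ℝ) * Real.cos (oscillatorPhase κ α t)

/-- The derivative of `oscillator`. -/
noncomputable def oscillatorDeriv (κ α t : ℝ) : ℝ :=
  t ^ (1 / 4 : ℝ) *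
    (Real.cos (oscillatorPhase κ α t) / (4 * t) - √κ / √t * Real.sin (oscillatorPhase κ α t))

theorem hasDerivAt_oscillatorPhase (ht : 0 < t) :
    HasDerivAt (oscillatorPhase κ α) (√κ / √t) t := by
  refine (((Real.hasDerivAt_sqrt ht.ne').const_mul (2 * √κ)).add_const α).congr_deriv ?_
  field_simp

theorem hasDerivAt_rpow_quarter (ht : 0 < t) :
    HasDerivAt (fun t : ℝ => t ^ (1 / 4 : ℝ)) (t ^ (1 / 4 : ℝ) / (4 * t)) t := by
  refine (Real.hasDerivAt_rpow_const (Or.inl ht.ne')).congr_deriv ?_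
  rw [Real.rpow_sub_one ht.ne']
  field_simp

theorem hasDerivAt_oscillator (ht : 0 < t) :
    HasDerivAt (oscillator κ α) (oscillatorDeriv κ α t) t := by
  refine ((hasDerivAt_rpow_quarter ht).mul (hasDerivAt_oscillatorPhase ht).cos).congr_deriv ?_
  rw [oscillatorDeriv]
  ring

theorem hasDerivAt_oscillatorDeriv (hκ : 0 ≤ κ) (ht : 0 < t) :
    HasDerivAt (oscillatorDeriv κ α) ((-(κ / t) - 3 / 16 / t ^ 2) * oscillator κ α t) t := by
  have hphase := hasDerivAt_oscillatorPhase (κ := κ) (α := α) ht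
  have hr : 0 < √t := Real.sqrt_pos.2 ht
  have hfreq : HasDerivAt (fun t => √κ / √t) (-(√κ / √t / (2 * t))) t := by
    refine ((hasDerivAt_const t √κ).div (Real.hasDerivAt_sqrt ht.ne') hr.ne').congr_deriv ?_
    rw [Real.sq_sqrt ht.le]
    field_simp
    ring
  refine ((hasDerivAt_rpow_quarter ht).mul
    ((hphase.cos.div ((hasDerivAt_id t).const_mul 4) (by positivity)).sub
      (hfreq.mul hphase.sin))).congr_deriv ?_
  have hfreq_sq : (√κ / √t) ^ 2 = κ / t := by rw [div_pow, Real.sq_sqrt hκ, Real.sq_sqrt ht.le]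
  rw [oscillator, ← hfreq_sq]
  simp only [Pi.sub_apply, Pi.div_apply, Pi.mul_apply, id_eq]
  field_simp
  ring

theorem oscillator_wronskian (ht : 0 < t) :
    oscillator κ 0 t * oscillatorDeriv κ (-(Real.pi / 2)) t
      - oscillatorDeriv κ 0 t * oscillator κ (-(Real.pi / 2)) t = √κ := by
  have hshift : oscillatorPhase κ (-(Real.pi / 2)) t = oscillatorPhase κ 0 t - Real.pi / 2 := by
    rw [oscillatorPhase, oscillatorPhase]; ring
  have hroot : t ^ (1 / 4 : ℝ) * t ^ (1 / 4 : ℝ) = √t := by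
    rw [← Real.rpow_add ht, Real.sqrt_eq_rpow]; norm_num
  have hr : √t ≠ 0 := (Real.sqrt_pos.2 ht).ne'
  rw [oscillator, oscillator, oscillatorDeriv, oscillatorDeriv, hshift, Real.cos_sub_pi_div_two,
    Real.sin_sub_pi_div_two]
  generalize oscillatorPhase κ 0 t = θ
  calc _ = t ^ (1 / 4 : ℝ) * t ^ (1 / 4 : ℝ) * (√κ / √t) * (Real.cos θ ^ 2 + Real.sin θ ^ 2) := by
        ring
    _ = √κ := by rw [hroot, Real.cos_sq_add_sin_sq, mul_one, mul_div_cancel₀ _ hr]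

theorem abs_oscillator_le (ht : 0 < t) : |oscillator κ α t| ≤ t ^ (1 / 4 : ℝ) := by
  rw [oscillator, abs_mul, abs_of_pos (Real.rpow_pos_of_pos ht _)]
  exact mul_le_of_le_one_right (by positivity) (Real.abs_cos_le_one _)

/-- The cosine and sine WKB solutions form a fundamental pair of `y'' = -(κ / t) y` corrected by
the term `-(3 / 16) t⁻² y` that makes them exact solutions. -/
noncomputable def oscillatorPair (hκ : 0 < κ) :
    FundamentalPair (fun t => -(κ / t) - 3 / 16 / t ^ 2) (1 / 4) where
  φ₁ := oscillator κ 0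
  φ₂ := oscillator κ (-(Real.pi / 2))
  φ₁' := oscillatorDeriv κ 0
  φ₂' := oscillatorDeriv κ (-(Real.pi / 2))
  W := √κ
  W_ne_zero := (Real.sqrt_pos.2 hκ).ne'
  wronskian_eq _ := oscillator_wronskian
  hasDerivAt₁ _ := hasDerivAt_oscillator
  hasDerivAt₂ _ := hasDerivAt_oscillator
  hasDerivAt₁' _ := hasDerivAt_oscillatorDeriv hκ.le
  hasDerivAt₂' _ := hasDerivAt_oscillatorDeriv hκ.le
  abs_le₁ _ := abs_oscillator_le
  abs_le₂ _ := abs_oscillator_le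

end Oscillator

section AsymptoticCalculus

variable {α : Type*} {l : Filter α} {f g a b z X V : α → ℝ} {p p' s : ℝ}

theorem isBigO_sq_mul_sub_one_add (hz : Tendsto z l (𝓝 0)) (ha : a =O[l] z) (hb : b =O[l] z)
    (hf : (fun i => f i - (1 + a i)) =O[l] (fun i => z i ^ 2))
    (hg : (fun i => g i - (1 + b i)) =O[l] (fun i => z i ^ 2)) :
    (fun i => f i * g i - (1 + (a i + b i))) =O[l] (fun i => z i ^ 2) := by
  have one_add_isBigO {c : α → ℝ} (hc : c =O[l] z) : (fun i => 1 + c i) =O[l] (1 : α → ℝ) :=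
    (isBigO_refl _ _).add (hc.trans (hz.isBigO_one ℝ))
  have hg1 : g =O[l] (1 : α → ℝ) := by
    have hz2 : (fun i => z i ^ 2) =O[l] (1 : α → ℝ) := (hz.pow 2).isBigO_one ℝ
    exact ((hg.trans hz2).add (one_add_isBigO hb)).congr_left fun i => by ring
  have h₁ : (fun i => (f i - (1 + a i)) * g i) =O[l] (fun i => z i ^ 2) := by
    simpa using hf.mul hg1
  have h₂ : (fun i => (1 + a i) * (g i - (1 + b i))) =O[l] (fun i => z i ^ 2) := by
    simpa using (one_add_isBigO ha).mul hg
  have h₃ : (fun i => a i * b i) =O[l] (fun i => z i ^ 2) := by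
    simpa only [sq] using ha.mul hb
  exact ((h₁.add h₂).add h₃).congr_left fun i => by ring

theorem isBigO_sq_exp_sub_one_add (hz : Tendsto z l (𝓝 0)) (ha : a =O[l] z) :
    (fun i => Real.exp (a i) - (1 + a i)) =O[l] (fun i => z i ^ 2) := by
  refine ((Real.exp_sub_sum_range_isBigO_pow 2).comp_tendsto (ha.trans_tendsto hz)).trans
    (ha.pow 2) |>.congr_left fun i => ?_
  simp [Finset.sum_range_succ]

theorem isBigO_exp_sub_one (hz : Tendsto z l (𝓝 0)) (ha : a =O[l] z) :
    (fun i => Real.exp (a i) - 1) =O[l] z := by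
  refine IsBigO.trans ?_ ha
  simpa [Function.comp_def] using
    (Real.hasDerivAt_exp 0).isBigO_sub.comp_tendsto (ha.trans_tendsto hz)

theorem isBigO_rpow_rpow_atTop (h : p ≤ p') :
    (fun x : ℝ => x ^ p) =O[atTop] (fun x : ℝ => x ^ p') := by
  refine IsBigO.of_bound' ?_
  filter_upwards [eventually_ge_atTop 1] with x hx
  rw [Real.norm_of_nonneg (by positivity), Real.norm_of_nonneg (by positivity)]
  exact Real.rpow_le_rpow_of_exponent_le hx h

theorem isBigO_rpow_mul_rpow_atTop (h : p + p' ≤ s) :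
    (fun x : ℝ => x ^ p * x ^ p') =O[atTop] (fun x : ℝ => x ^ s) := by
  refine (isBigO_rpow_rpow_atTop h).congr' ?_ EventuallyEq.rfl
  filter_upwards [eventually_gt_atTop 0] with x hx using Real.rpow_add hx _ _

theorem isBigO_one_rpow_atTop (h : 0 ≤ p) : (fun _ => (1 : ℝ)) =O[atTop] (fun x : ℝ => x ^ p) := by
  simpa using isBigO_rpow_rpow_atTop h

theorem tendsto_rpow_atTop_zero (h : p < 0) : Tendsto (fun x : ℝ => x ^ p) atTop (𝓝 0) := by
  simpa using tendsto_rpow_neg_atTop (neg_pos.2 h)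

theorem isEquivalent_of_sub_isBigO_rpow (hs : s < 1) (hX : Tendsto X l atTop)
    (hV : (fun i => V i - X i) =O[l] (fun i => X i ^ s)) : V ~[l] X := by
  have hlittle : (fun x : ℝ => x ^ s) =o[atTop] (fun x => x) := by
    refine isLittleO_of_tendsto' ((eventually_ne_atTop 0).mono fun x hx hx0 => absurd hx0 hx)
      ((tendsto_rpow_atTop_zero (sub_neg.2 hs)).congr' ?_)
    filter_upwards [eventually_ne_atTop 0] with x hx using Real.rpow_sub_one hx s
  exact hV.trans_isLittleO (hlittle.comp_tendsto hX)

theorem tendsto_div_one_of_isEquivalent (hX : Tendsto X l atTop) (hV : V ~[l] X) :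
    Tendsto (fun i => V i / X i) l (𝓝 1) :=
  (isEquivalent_iff_tendsto_one (hX.eventually_ne_atTop 0)).1 hV

theorem isTheta_rpow_of_isEquivalent (p : ℝ) (hX : Tendsto X l atTop) (hV : V ~[l] X) :
    (fun i => V i ^ p) =Θ[l] (fun i => X i ^ p) :=
  hV.isTheta.rpow ((hV.tendsto_atTop_iff.2 hX).eventually_ge_atTop 0) (hX.eventually_ge_atTop 0)

theorem isBigO_rpow_sub_rpow (p : ℝ) (hX : Tendsto X l atTop) (hV : V ~[l] X) :
    (fun i => V i ^ p - X i ^ p) =O[l] (fun i => X i ^ (p - 1) * (V i - X i)) := by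
  have hratio := (Real.hasDerivAt_rpow_const (p := p) (Or.inl one_ne_zero)).isBigO_sub.comp_tendsto
    (tendsto_div_one_of_isEquivalent hX hV)
  refine ((isBigO_refl (fun i => X i ^ p) l).mul hratio).congr' ?_ ?_
  · filter_upwards [hX.eventually_gt_atTop 0, (hV.tendsto_atTop_iff.2 hX).eventually_gt_atTop 0]
      with i hXi hVi
    have hpow : X i ^ p ≠ 0 := (Real.rpow_pos_of_pos hXi p).ne'
    simp only [Function.comp_apply, Real.one_rpow, Real.div_rpow hVi.le hXi.le]
    field_simp
  · filter_upwards [hX.eventually_gt_atTop 0] with i hXi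
    simp only [Function.comp_apply, Real.rpow_sub_one hXi.ne']
    field_simp

theorem isBigO_log_sub_log (hX : Tendsto X l atTop) (hV : V ~[l] X) :
    (fun i => Real.log (V i) - Real.log (X i)) =O[l] (fun i => (X i)⁻¹ * (V i - X i)) := by
  have hratio := (Real.hasDerivAt_log one_ne_zero).isBigO_sub.comp_tendsto
    (tendsto_div_one_of_isEquivalent hX hV)
  refine hratio.congr' ?_ ?_
  · filter_upwards [hX.eventually_gt_atTop 0, (hV.tendsto_atTop_iff.2 hX).eventually_gt_atTop 0]
      with i hXi hVi
    simp [Real.log_div hVi.ne' hXi.ne']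
  · filter_upwards [hX.eventually_gt_atTop 0] with i hXi
    simp only [Function.comp_apply]
    field_simp

end AsymptoticCalculus

section ApproximateSolution

variable {q r : ℝ}

/-- The constant `K` in the leading behaviour `4 T'' / (T')³ ∼ K x^(1-2q)` for `T(x) ∼ x^q`. -/
noncomputable def leadConst (q : ℝ) : ℝ := 4 * (q - 1) / q ^ 2

/-- The coefficient of `x^(r-q)` in the approximate hodograph `apxTime`; it is the value for which
the terms of relative order `x^(r-q)` in the residual cancel. -/
noncomputable def coeffA (q r : ℝ) : ℝ := 3 * (r / q) - r * (r - 1) / (q * (q - 1))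

/-- The coefficient of `x^(-q)` in the approximate hodograph `apxTime`; it is the value for which
the terms of relative order `x^(-q)` in the residual cancel. -/
noncomputable def coeffC (q : ℝ) : ℝ := 3 * ((2 * q - 1) / q) + (2 * q - 1) / (q * (q - 1))

/-- The approximate hodograph: a singular solution `v`, as a function of `τ = -log |x|²`,
satisfies `τ ≈ apxTime q r (v τ)`. -/
noncomputable def apxTime (q r x : ℝ) : ℝ :=
  x ^ q + x ^ r + (2 * q - 1) * Real.log x - Real.log (leadConst q)
    + coeffA q r * x ^ (r - q) + coeffC q * x ^ (-q)

/-- The ratio of the derivative of `apxTime q r` to its leading term `q x^(q-1)`. -/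
noncomputable def derivFactor (q r x : ℝ) : ℝ :=
  1 + (r / q * x ^ (r - q) + (2 * q - 1) / q * x ^ (-q))
    + (coeffA q r * (r - q) / q * (x ^ (r - q) * x ^ (-q)) - coeffC q * (x ^ (-q) * x ^ (-q)))

/-- The ratio of the second derivative of `apxTime q r` to its leading term `q (q-1) x^(q-2)`. -/
noncomputable def derivFactor₂ (q r x : ℝ) : ℝ :=
  1 + (r * (r - 1) / (q * (q - 1)) * x ^ (r - q) - (2 * q - 1) / (q * (q - 1)) * x ^ (-q))
    + (coeffA q r * (r - q) * (r - q - 1) / (q * (q - 1)) * (x ^ (r - q) * x ^ (-q))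
      + coeffC q * (q + 1) / (q - 1) * (x ^ (-q) * x ^ (-q)))

/-- The derivative of `apxTime q r`, in the factored form used by the expansions. -/
noncomputable def apxTimeDeriv (q r x : ℝ) : ℝ := q * x ^ (q - 1) * derivFactor q r x

/-- The second derivative of `apxTime q r`, in the factored form used by the expansions. -/
noncomputable def apxTimeDeriv₂ (q r x : ℝ) : ℝ := q * (q - 1) * x ^ (q - 2) * derivFactor₂ q r x

theorem leadConst_pos (hq : 1 < q) : 0 < leadConst q := by
  have : 0 < q - 1 := sub_pos.2 hq
  unfold leadConst
  positivity

theorem hasDerivAt_apxTime (hq : 0 < q) {x : ℝ} (hx : 0 < x) :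
    HasDerivAt (apxTime q r) (apxTimeDeriv q r x) x := by
  have hpow (p : ℝ) := Real.hasDerivAt_rpow_const (x := x) (p := p) (Or.inl hx.ne')
  refine ((((((hpow q).add (hpow r)).add ((Real.hasDerivAt_log hx.ne').const_mul
    (2 * q - 1))).sub_const _).add ((hpow (r - q)).const_mul _)).add
    ((hpow (-q)).const_mul _)).congr_deriv ?_
  simp only [apxTimeDeriv, derivFactor, Real.rpow_sub hx, Real.rpow_neg hx.le, Real.rpow_one]
  field_simp
  ring

theorem hasDerivAt_apxTimeDeriv (hq : 1 < q) {x : ℝ} (hx : 0 < x) :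
    HasDerivAt (apxTimeDeriv q r) (apxTimeDeriv₂ q r x) x := by
  have hq₁ : q - 1 ≠ 0 := (sub_pos.2 hq).ne'
  have hpow (p : ℝ) := Real.hasDerivAt_rpow_const (x := x) (p := p) (Or.inl hx.ne')
  refine (((hpow (q - 1)).const_mul q).mul
    ((((hpow (r - q)).const_mul (r / q)).add ((hpow (-q)).const_mul ((2 * q - 1) / q))
      |>.const_add 1).add (((((hpow (r - q)).mul (hpow (-q))).const_mul _)).sub
        (((hpow (-q)).mul (hpow (-q))).const_mul _)))).congr_deriv ?_
  simp only [apxTimeDeriv₂, derivFactor₂, Real.rpow_sub hx, Real.rpow_neg hx.le, Real.rpow_one,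
    Real.rpow_two, Pi.add_apply, Pi.mul_apply, Pi.sub_apply]
  field_simp
  ring

theorem exp_sub_apxTime (hq : 1 < q) {x : ℝ} (hx : 0 < x) :
    Real.exp (x ^ q + x ^ r - apxTime q r x) = leadConst q * x ^ (1 - 2 * q)
      * Real.exp (-coeffA q r * x ^ (r - q) + -coeffC q * x ^ (-q)) := by
  nth_rewrite 1 [← Real.exp_log (leadConst_pos hq)]
  rw [Real.rpow_def_of_pos hx (1 - 2 * q), ← Real.exp_add, ← Real.exp_add]
  unfold apxTime
  congr 1
  ring

theorem isBigO_linear_combination_rpow (hr : 0 < r) (c d : ℝ) :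
    (fun x : ℝ => c * x ^ (r - q) + d * x ^ (-q)) =O[atTop] (fun x => x ^ (r - q)) :=
  (isBigO_const_mul_self c _ _).add
    ((isBigO_rpow_rpow_atTop (by linarith)).const_mul_left d)

theorem isBigO_quadratic_combination_rpow (hr : 0 < r) (c d : ℝ) :
    (fun x : ℝ => c * (x ^ (r - q) * x ^ (-q)) + d * (x ^ (-q) * x ^ (-q)))
      =O[atTop] (fun x => (x ^ (r - q)) ^ 2) := by
  have hw : (fun x : ℝ => x ^ (-q)) =O[atTop] (fun x => x ^ (r - q)) :=
    isBigO_rpow_rpow_atTop (by linarith)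
  exact ((isBigO_linear_combination_rpow hr c d).mul hw).congr (fun x => by ring) fun x => by ring

theorem derivFactor_expansion (hr : 0 < r) :
    (fun x => derivFactor q r x - (1 + (r / q * x ^ (r - q) + (2 * q - 1) / q * x ^ (-q))))
      =O[atTop] (fun x => (x ^ (r - q)) ^ 2) :=
  (isBigO_quadratic_combination_rpow hr (coeffA q r * (r - q) / q) (-coeffC q)).congr_left
    fun x => by
      unfold derivFactor
      ring

theorem derivFactor₂_expansion (hr : 0 < r) :
    (fun x => derivFactor₂ q r x - (1 + (r * (r - 1) / (q * (q - 1)) * x ^ (r - q)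
      + -((2 * q - 1) / (q * (q - 1))) * x ^ (-q)))) =O[atTop] (fun x => (x ^ (r - q)) ^ 2) :=
  (isBigO_quadratic_combination_rpow hr (coeffA q r * (r - q) * (r - q - 1) / (q * (q - 1)))
    (coeffC q * (q + 1) / (q - 1))).congr_left fun x => by
      unfold derivFactor₂
      ring

theorem tendsto_derivFactor (hr : 0 < r) (hrq : r < q) :
    Tendsto (derivFactor q r) atTop (𝓝 1) := by
  have hz := tendsto_rpow_atTop_zero (sub_neg.2 hrq)
  have hz2 : Tendsto (fun x : ℝ => (x ^ (r - q)) ^ 2) atTop (𝓝 0) := by simpa using hz.pow 2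
  have hlin := (isBigO_linear_combination_rpow hr (r / q) ((2 * q - 1) / q)).trans_tendsto hz
  have hsum := ((derivFactor_expansion hr).trans_tendsto hz2).add (hlin.const_add 1)
  simpa using hsum

theorem derivFactor_residual (hr : 0 < r) (hrq : r < q) :
    (fun x => derivFactor q r x * (derivFactor q r x * derivFactor q r x)
      * Real.exp (-coeffA q r * x ^ (r - q) + -coeffC q * x ^ (-q)) - derivFactor₂ q r x)
      =O[atTop] (fun x => (x ^ (r - q)) ^ 2) := by
  have hz := tendsto_rpow_atTop_zero (sub_neg.2 hrq)
  have hlin := isBigO_linear_combination_rpow (q := q) hr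
  have hD := derivFactor_expansion (q := q) hr
  have hexp := isBigO_sq_exp_sub_one_add hz (hlin (-coeffA q r) (-coeffC q))
  have hDD := isBigO_sq_mul_sub_one_add hz (hlin _ _) (hlin _ _) hD hD
  have hDDD := isBigO_sq_mul_sub_one_add hz (hlin _ _) ((hlin _ _).add (hlin _ _)) hD hDD
  have hprod := isBigO_sq_mul_sub_one_add hz ((hlin _ _).add ((hlin _ _).add (hlin _ _)))
    (hlin _ _) hDDD hexp
  refine (hprod.sub (derivFactor₂_expansion hr)).congr_left fun x => ?_
  simp only [coeffA, coeffC]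
  ring

/-- The residual of the equation `v'' = -exp(v^q + v^r - τ) / 4` at the inverse function `X` of
`apxTime q r`, for which `X'' = -T''/(T')³`, written in terms of `x = X τ`. -/
noncomputable def apxResidual (q r x : ℝ) : ℝ :=
  Real.exp (x ^ q + x ^ r - apxTime q r x) - 4 * apxTimeDeriv₂ q r x / apxTimeDeriv q r x ^ 3

theorem apxResidual_isBigO (hq : 1 < q) (hr : 0 < r) (hrq : r < q) :
    apxResidual q r =O[atTop] (fun x => x ^ (1 + 2 * r - 4 * q)) := by
  have hD := tendsto_derivFactor hr hrq
  have hDinv : (fun x => (derivFactor q r x ^ 3)⁻¹) =O[atTop] (fun _ => (1 : ℝ)) :=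
    ((hD.pow 3).inv₀ (by norm_num)).isBigO_one ℝ
  have hmain := (isBigO_const_mul_self (leadConst q) (fun x : ℝ => x ^ (1 - 2 * q)) atTop).mul
    ((derivFactor_residual hr hrq).mul hDinv)
  refine hmain.congr' ?_ ?_
  · filter_upwards [eventually_gt_atTop 0, hD.eventually_const_lt zero_lt_one] with x hx hDx
    have : 0 < x ^ (q - 1) := by positivity
    have hsplit : x ^ (q - 2) = x ^ (1 - 2 * q) * (x ^ (q - 1)) ^ 3 := by
      rw [← Real.rpow_mul_natCast hx.le, ← Real.rpow_add hx]
      congr 1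
      push_cast
      ring
    rw [apxResidual, exp_sub_apxTime hq hx, apxTimeDeriv, apxTimeDeriv₂, hsplit, leadConst]
    field_simp
  · filter_upwards [eventually_gt_atTop 0] with x hx
    rw [mul_one, ← Real.rpow_mul_natCast hx.le, ← Real.rpow_add hx]
    congr 1
    push_cast
    ring

theorem apxTime_sub_rpow_isBigO (hr : 0 < r) (hrq : r < q) :
    (fun x => apxTime q r x - x ^ q) =O[atTop] (fun x => x ^ r) := by
  have hlog : Real.log =O[atTop] (fun x => x ^ r) := (isLittleO_log_rpow_atTop hr).isBigO
  have hconst : (fun _ : ℝ => Real.log (leadConst q)) =O[atTop] (fun x : ℝ => x ^ r) :=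
    (isBigO_const_const _ one_ne_zero _).trans (isBigO_one_rpow_atTop hr.le)
  have hlow := (isBigO_linear_combination_rpow (q := q) hr (coeffA q r) (coeffC q)).trans
    (isBigO_rpow_rpow_atTop (show r - q ≤ r by linarith))
  refine ((((isBigO_refl _ _).add (hlog.const_mul_left (2 * q - 1))).sub hconst).add
    hlow).congr_left fun x => ?_
  unfold apxTime
  ring

theorem apxTime_isEquivalent (hr : 0 < r) (hrq : r < q) :
    apxTime q r ~[atTop] (fun x => x ^ q) := by
  refine isEquivalent_of_sub_isBigO_rpow (s := r / q) ((div_lt_one (hr.trans hrq)).2 hrq)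
    (tendsto_rpow_atTop (hr.trans hrq)) ?_
  refine (apxTime_sub_rpow_isBigO hr hrq).congr' EventuallyEq.rfl ?_
  filter_upwards [eventually_ge_atTop 0] with x hx
  rw [← Real.rpow_mul hx, mul_div_cancel₀ _ (hr.trans hrq).ne']

theorem tendsto_apxTime_atTop (hr : 0 < r) (hrq : r < q) : Tendsto (apxTime q r) atTop atTop :=
  (apxTime_isEquivalent hr hrq).tendsto_atTop_iff.2 (tendsto_rpow_atTop (hr.trans hrq))

theorem inv_apxTime_sub_isBigO (hr : 0 < r) (hrq : r < q) :
    (fun x => (apxTime q r x)⁻¹ - x ^ (-q)) =O[atTop] (fun x => x ^ (r - 2 * q)) := by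
  have hq := hr.trans hrq
  have hinv := (isBigO_rpow_sub_rpow (-1) (tendsto_rpow_atTop hq)
    (apxTime_isEquivalent hr hrq)).trans
    ((isBigO_refl _ _).mul (apxTime_sub_rpow_isBigO hr hrq))
  refine hinv.congr' ?_ ?_
  · filter_upwards [eventually_gt_atTop 0] with x hx
    rw [Real.rpow_neg_one, Real.rpow_neg_one, Real.rpow_neg hx.le]
  · filter_upwards [eventually_gt_atTop 0] with x hx
    rw [← Real.rpow_mul hx.le, ← Real.rpow_add hx]
    congr 1
    ring

end ApproximateSolution

section Linearization

variable {q r s : ℝ} {α : Type*} {l : Filter α} {X V : α → ℝ}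

theorem isBigO_rpow_sub_rpow_of_near (p : ℝ) (hs : s < 1) (hX : Tendsto X l atTop)
    (hV : (fun i => V i - X i) =O[l] (fun i => X i ^ s)) :
    (fun i => V i ^ p - X i ^ p) =O[l] (fun i => X i ^ (p - 1 + s)) :=
  ((isBigO_rpow_sub_rpow p hX (isEquivalent_of_sub_isBigO_rpow hs hX hV)).trans
    ((isBigO_refl _ _).mul hV)).trans
    ((isBigO_rpow_mul_rpow_atTop le_rfl).comp_tendsto hX)

theorem isBigO_nonlinearity_sub (hr : 0 < r) (hrq : r < q) (hX : Tendsto X l atTop)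
    (hV : (fun i => V i - X i) =O[l] (fun i => X i ^ (r - 2 * q + 1))) :
    (fun i => V i ^ q - X i ^ q + (V i ^ r - X i ^ r)) =O[l] (fun i => X i ^ (r - q)) := by
  have hpow {p : ℝ} (hp : p ≤ q) :
      (fun i => V i ^ p - X i ^ p) =O[l] (fun i => X i ^ (r - q)) :=
    (isBigO_rpow_sub_rpow_of_near p (by linarith) hX hV).trans
      ((isBigO_rpow_rpow_atTop (by linarith)).comp_tendsto hX)
  exact (hpow le_rfl).add (hpow hrq.le)

theorem isBigO_exp_sub_apxTime (hq : 1 < q) (hr : 0 < r) (hrq : r < q) (hX : Tendsto X l atTop)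
    (hV : (fun i => V i - X i) =O[l] (fun i => X i ^ (r - 2 * q + 1))) :
    (fun i => Real.exp (V i ^ q + V i ^ r - apxTime q r (X i)) - leadConst q * X i ^ (1 - 2 * q))
      =O[l] (fun i => X i ^ (1 - 2 * q + (r - q))) := by
  have hexp := isBigO_exp_sub_one ((tendsto_rpow_atTop_zero (sub_neg.2 hrq)).comp hX)
    ((isBigO_nonlinearity_sub hr hrq hX hV).add
      ((isBigO_linear_combination_rpow hr (-coeffA q r) (-coeffC q)).comp_tendsto hX))
  have hprod := (isBigO_const_mul_self (leadConst q) (fun i => X i ^ (1 - 2 * q)) l).mul hexp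
  refine (hprod.trans ((isBigO_rpow_mul_rpow_atTop le_rfl).comp_tendsto hX)).congr' ?_
    EventuallyEq.rfl
  filter_upwards [hX.eventually_gt_atTop 0] with i hi
  have hsplit : V i ^ q + V i ^ r - apxTime q r (X i) = (X i ^ q + X i ^ r - apxTime q r (X i))
      + (V i ^ q - X i ^ q + (V i ^ r - X i ^ r)) := by ring
  rw [hsplit, Real.exp_add _ (V i ^ q - X i ^ q + (V i ^ r - X i ^ r)),
    exp_sub_apxTime hq hi, Function.comp_apply, Real.exp_add (V i ^ q - X i ^ q + _)]
  ring

theorem isBigO_deriv_nonlinearity_sub (hr : 0 < r) (hrq : r < q) (hX : Tendsto X l atTop)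
    (hV : (fun i => V i - X i) =O[l] (fun i => X i ^ (r - 2 * q + 1))) :
    (fun i => (q * V i ^ (q - 1) + r * V i ^ (r - 1)) - q * X i ^ (q - 1))
      =O[l] (fun i => X i ^ (r - 1)) := by
  have hpow {p : ℝ} (hp : p ≤ q) :
      (fun i => V i ^ (p - 1) - X i ^ (p - 1)) =O[l] (fun i => X i ^ (r - 1)) :=
    (isBigO_rpow_sub_rpow_of_near (p - 1) (by linarith) hX hV).trans
      ((isBigO_rpow_rpow_atTop (by linarith)).comp_tendsto hX)
  refine ((((hpow le_rfl).const_mul_left q).add ((hpow hrq.le).const_mul_left r)).add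
    (isBigO_const_mul_self r _ l)).congr_left fun i => ?_
  ring

theorem isBigO_linearization_sub (hq : 1 < q) (hr : 0 < r) (hrq : r < q)
    (hX : Tendsto X l atTop)
    (hV : (fun i => V i - X i) =O[l] (fun i => X i ^ (r - 2 * q + 1))) :
    (fun i => (q * V i ^ (q - 1) + r * V i ^ (r - 1))
        * Real.exp (V i ^ q + V i ^ r - apxTime q r (X i))
        - q * leadConst q * (apxTime q r (X i))⁻¹) =O[l] (fun i => X i ^ (r - 2 * q)) := by
  have hmul {p p' : ℝ} (h : p + p' ≤ r - 2 * q) :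
      (fun i => X i ^ p * X i ^ p') =O[l] (fun i => X i ^ (r - 2 * q)) :=
    (isBigO_rpow_mul_rpow_atTop h).comp_tendsto hX
  have hexp := isBigO_exp_sub_apxTime hq hr hrq hX hV
  have hexp' : (fun i => Real.exp (V i ^ q + V i ^ r - apxTime q r (X i)))
      =O[l] (fun i => X i ^ (1 - 2 * q)) := by
    refine ((hexp.trans ((isBigO_rpow_rpow_atTop (by linarith)).comp_tendsto hX)).add
      (isBigO_const_mul_self (leadConst q) (fun i => X i ^ (1 - 2 * q)) l)).congr_left fun i => ?_
    ring
  have h₁ := ((isBigO_deriv_nonlinearity_sub hr hrq hX hV).mul hexp').trans (hmul (by linarith))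
  have h₂ := ((isBigO_const_mul_self q (fun i => X i ^ (q - 1)) l).mul hexp).trans
    (hmul (by linarith))
  have h₃ := ((inv_apxTime_sub_isBigO hr hrq).comp_tendsto hX).const_mul_left (q * leadConst q)
  refine ((h₁.add h₂).sub h₃).congr' ?_ EventuallyEq.rfl
  filter_upwards [hX.eventually_gt_atTop 0] with i hi
  have hpow : X i ^ (q - 1) * X i ^ (1 - 2 * q) = X i ^ (-q) := by
    rw [← Real.rpow_add hi]
    congr 1
    ring
  simp only [Function.comp_apply]
  linear_combination (-q * leadConst q) * hpow

end Linearization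

section InverseFunction

variable {T T' : ℝ → ℝ} {x₀ q r : ℝ}

/-- The extension of `T` to the left of `x₀` by an affine function of slope one. It makes the
inverse of a function increasing on `[x₀, ∞)` available as the inverse of an order isomorphism. -/
noncomputable def affineExtension (T : ℝ → ℝ) (x₀ x : ℝ) : ℝ := T (max x x₀) + min (x - x₀) 0

theorem affineExtension_of_le {x : ℝ} (h : x₀ ≤ x) : affineExtension T x₀ x = T x := by
  simp [affineExtension, h]

theorem affineExtension_of_ge {x : ℝ} (h : x ≤ x₀) : affineExtension T x₀ x = T x₀ + (x - x₀) := by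
  simp [affineExtension, h]

theorem strictMono_affineExtension (hT : StrictMonoOn T (Set.Ici x₀)) :
    StrictMono (affineExtension T x₀) := by
  refine (StrictMonoOn.Iic_union_Ici (a := x₀) (fun x hx y hy hxy => ?_) fun x hx y hy hxy => ?_)
  · simpa only [affineExtension_of_ge hx, affineExtension_of_ge hy, add_lt_add_iff_left,
      sub_lt_sub_iff_right] using hxy
  · simpa only [affineExtension_of_le hx, affineExtension_of_le hy] using hT hx hy hxy

theorem surjective_affineExtension (hT : ContinuousOn T (Set.Ici x₀))
    (hlim : Tendsto T atTop atTop) : Function.Surjective (affineExtension T x₀) := by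
  refine Continuous.surjective ?_ ?_ ?_
  · exact (hT.comp_continuous (by fun_prop) fun x => le_max_right x x₀).add (by fun_prop)
  · refine hlim.congr' ?_
    filter_upwards [eventually_ge_atTop x₀] with x hx using (affineExtension_of_le hx).symm
  · refine (tendsto_atBot_add_const_left _ (T x₀)
      (tendsto_atBot_add_const_right _ (-x₀) tendsto_id)).congr' ?_
    filter_upwards [eventually_le_atBot x₀] with x hx using (affineExtension_of_ge hx).symm

theorem exists_eventual_inverse (hderiv : ∀ᶠ x in atTop, HasDerivAt T (T' x) x)
    (hpos : ∀ᶠ x in atTop, 0 < T' x) (hlim : Tendsto T atTop atTop) :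
    ∃ X : ℝ → ℝ, Tendsto X atTop atTop ∧
      ∀ᶠ τ in atTop, T (X τ) = τ ∧ HasDerivAt X (T' (X τ))⁻¹ τ := by
  obtain ⟨x₀, hx₀⟩ := eventually_atTop.1 (hderiv.and hpos)
  have hcont : ContinuousOn T (Set.Ici x₀) := fun x hx =>
    (hx₀ x hx).1.continuousAt.continuousWithinAt
  have hmono : StrictMonoOn T (Set.Ici x₀) := by
    refine strictMonoOn_of_deriv_pos (convex_Ici _) hcont fun x hx => ?_
    have hx' : x₀ ≤ x := interior_subset hx
    rw [(hx₀ x hx').1.deriv]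
    exact (hx₀ x hx').2
  let e : ℝ ≃o ℝ := (strictMono_affineExtension hmono).orderIsoOfSurjective _
    (surjective_affineExtension hcont hlim)
  have hinv {τ : ℝ} (hτ : x₀ ≤ e.symm τ) : T (e.symm τ) = τ :=
    (affineExtension_of_le hτ).symm.trans (e.apply_symm_apply τ)
  refine ⟨e.symm, e.symm.tendsto_atTop, ?_⟩
  filter_upwards [e.symm.tendsto_atTop.eventually_gt_atTop x₀] with τ hτ
  obtain ⟨hderivτ, hposτ⟩ := hx₀ _ hτ.le
  refine ⟨hinv hτ.le, hderivτ.of_local_left_inverse e.symm.continuous.continuousAt hposτ.ne' ?_⟩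
  filter_upwards [e.symm.continuous.continuousAt.eventually (lt_mem_nhds hτ)] with σ hσ
    using hinv hσ.le

/-- An approximate solution is an eventual inverse of `apxTime q r`, with its derivative; it solves
`X'' = -exp(X^q + X^r - τ) / 4` up to the residual `apxResidual q r (X τ) / 4`. -/
structure IsApxSolution (q r : ℝ) (X : ℝ → ℝ) : Prop where
  tendsto : Tendsto X atTop atTop
  apxTime_eq : ∀ᶠ τ in atTop, apxTime q r (X τ) = τ
  hasDerivAt : ∀ᶠ τ in atTop, HasDerivAt X (apxTimeDeriv q r (X τ))⁻¹ τ

theorem eventually_apxTimeDeriv_pos (hr : 0 < r) (hrq : r < q) :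
    ∀ᶠ x in atTop, 0 < apxTimeDeriv q r x := by
  filter_upwards [(tendsto_derivFactor hr hrq).eventually_const_lt zero_lt_one,
    eventually_gt_atTop 0] with x hD hx
  have hq := hr.trans hrq
  unfold apxTimeDeriv
  positivity

theorem exists_isApxSolution (hr : 0 < r) (hrq : r < q) : ∃ X, IsApxSolution q r X := by
  obtain ⟨X, hX, hinv⟩ := exists_eventual_inverse
    ((eventually_gt_atTop 0).mono fun x hx => hasDerivAt_apxTime (hr.trans hrq) hx)
    (eventually_apxTimeDeriv_pos hr hrq) (tendsto_apxTime_atTop hr hrq)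
  exact ⟨X, hX, hinv.mono fun _ h => h.1, hinv.mono fun _ h => h.2⟩

namespace IsApxSolution

variable {X : ℝ → ℝ} (hX : IsApxSolution q r X)
include hX

theorem hasDerivAt_deriv (hq : 1 < q) (hr : 0 < r) (hrq : r < q) :
    ∀ᶠ τ in atTop, HasDerivAt (fun σ => (apxTimeDeriv q r (X σ))⁻¹)
      (-(Real.exp (X τ ^ q + X τ ^ r - τ) - apxResidual q r (X τ)) / 4) τ := by
  filter_upwards [hX.hasDerivAt, hX.apxTime_eq, hX.tendsto.eventually_gt_atTop 0,
    hX.tendsto.eventually (eventually_apxTimeDeriv_pos hr hrq)] with τ hderiv htime hpos hderiv_pos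
  refine ((hasDerivAt_apxTimeDeriv hq hpos).comp τ hderiv |>.fun_inv hderiv_pos.ne').congr_deriv ?_
  rw [apxResidual, htime, Function.comp_apply]
  field_simp
  ring

theorem rpow_isTheta (hr : 0 < r) (hrq : r < q) (p : ℝ) :
    (fun τ => X τ ^ p) =Θ[atTop] (fun τ : ℝ => τ ^ (p / q)) := by
  have hq := hr.trans hrq
  have hequiv : (fun τ => X τ ^ q) ~[atTop] (fun τ : ℝ => τ) :=
    ((apxTime_isEquivalent hr hrq).comp_tendsto hX.tendsto).symm.congr_right hX.apxTime_eq
  refine EventuallyEq.trans_isTheta ?_ (isTheta_rpow_of_isEquivalent (p / q) tendsto_id hequiv)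
  filter_upwards [hX.tendsto.eventually_ge_atTop 0] with τ hτ
  rw [← Real.rpow_mul hτ, mul_div_cancel₀ _ hq.ne']

end IsApxSolution

end InverseFunction

section Existence

variable {q r : ℝ}

/-- The filter of points `(τ, y)` with `τ → ∞` inside the tube `|y| ≤ τ ^ e`; estimates along it
are uniform in `y`. -/
def tubeFilter (e : ℝ) : Filter (ℝ × ℝ) :=
  comap Prod.fst atTop ⊓ 𝓟 {p : ℝ × ℝ | |p.2| ≤ p.1 ^ e}

theorem eventually_tubeFilter {e : ℝ} {P : ℝ → ℝ → Prop} :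
    (∀ᶠ p in tubeFilter e, P p.1 p.2) ↔ ∀ᶠ τ in atTop, ∀ y, |y| ≤ τ ^ e → P τ y := by
  rw [tubeFilter, eventually_inf_principal, eventually_comap]
  refine eventually_congr (Eventually.of_forall fun τ => ⟨fun h y hy => h (τ, y) rfl hy, ?_⟩)
  rintro h ⟨_, y⟩ rfl hy
  exact h y hy

theorem tendsto_fst_tubeFilter (e : ℝ) : Tendsto Prod.fst (tubeFilter e) atTop :=
  tendsto_comap.mono_left inf_le_left

theorem snd_isBigO_tubeFilter (e : ℝ) :
    (fun p : ℝ × ℝ => p.2) =O[tubeFilter e] (fun p => p.1 ^ e) := by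
  refine IsBigO.of_bound' ((eventually_tubeFilter (P := fun τ y => ‖y‖ ≤ ‖τ ^ e‖)).2 ?_)
  exact Eventually.of_forall fun τ y hy => hy.trans (le_abs_self _)

/-- The exponent of the tube `|v - X| ≤ τ ^ e` around the approximate solution, corresponding to
the power `X ^ (r - 2q + 1)`. -/
noncomputable def tubeExponent (q r : ℝ) : ℝ := (r - 2 * q + 1) / q

/-- The perturbation `N` for which `v = X + φ` solves `v'' = -exp(v^q + v^r - τ) / 4` if and only if
`φ'' = -(κ/τ + 3/(16 τ²)) φ + N(τ, φ)`, with `κ = (q-1)/q`. -/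
noncomputable def emdenPerturbation (q r : ℝ) (X : ℝ → ℝ) (τ y : ℝ) : ℝ :=
  (Real.exp (X τ ^ q + X τ ^ r - τ) - apxResidual q r (X τ)
    - Real.exp ((X τ + y) ^ q + (X τ + y) ^ r - τ)) / 4
  + ((q - 1) / q / τ + 3 / 16 / τ ^ 2) * y

/-- The derivative of `emdenPerturbation q r X τ` in its last argument. -/
noncomputable def emdenPerturbationDeriv (q r : ℝ) (X : ℝ → ℝ) (τ y : ℝ) : ℝ :=
  (q - 1) / q / τ + 3 / 16 / τ ^ 2
    - (q * (X τ + y) ^ (q - 1) + r * (X τ + y) ^ (r - 1))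
      * Real.exp ((X τ + y) ^ q + (X τ + y) ^ r - τ) / 4

theorem hasDerivAt_emdenPerturbation {X : ℝ → ℝ} {τ y : ℝ} (hpos : 0 < X τ + y) :
    HasDerivAt (emdenPerturbation q r X τ) (emdenPerturbationDeriv q r X τ y) y := by
  have hshift : HasDerivAt (fun y => X τ + y) 1 y := (hasDerivAt_id y).const_add _
  have hexp := (((hshift.rpow_const (p := q) (Or.inl hpos.ne')).add
    (hshift.rpow_const (p := r) (Or.inl hpos.ne'))).sub_const τ).exp
  refine (((hexp.const_sub _).div_const 4).add
    ((hasDerivAt_id y).const_mul ((q - 1) / q / τ + 3 / 16 / τ ^ 2))).congr_deriv ?_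
  simp only [emdenPerturbationDeriv, Pi.add_apply]
  ring

theorem continuousAt_apxResidual (hq : 1 < q) {x : ℝ} (hx : 0 < x)
    (hderiv : apxTimeDeriv q r x ≠ 0) : ContinuousAt (apxResidual q r) x := by
  have hT := (hasDerivAt_apxTime (r := r) (zero_lt_one.trans hq) hx).continuousAt
  have hT' := (hasDerivAt_apxTimeDeriv (r := r) hq hx).continuousAt
  have hT₂ : ContinuousAt (apxTimeDeriv₂ q r) x := by
    unfold apxTimeDeriv₂ derivFactor₂
    fun_prop (disch := exact Or.inl hx.ne')
  have hpow (p : ℝ) := Real.continuousAt_rpow_const x p (Or.inl hx.ne')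
  exact (((hpow q).add (hpow r)).sub hT).rexp.sub
    ((hT₂.const_mul 4).div (hT'.pow 3) (pow_ne_zero 3 hderiv))

theorem continuousAt_uncurry_emdenPerturbation (hq : 1 < q) (hr : 0 < r) {X : ℝ → ℝ} {p : ℝ × ℝ}
    (hτ : 0 < p.1) (hX : ContinuousAt X p.1) (hpos : 0 < X p.1)
    (hderiv : apxTimeDeriv q r (X p.1) ≠ 0) :
    ContinuousAt (Function.uncurry (emdenPerturbation q r X)) p := by
  have hfst : ContinuousAt (fun p : ℝ × ℝ => p.1) p := continuousAt_fst
  have hXfst : ContinuousAt (fun p : ℝ × ℝ => X p.1) p := hX.comp hfst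
  have hres : ContinuousAt (fun p : ℝ × ℝ => apxResidual q r (X p.1)) p :=
    ContinuousAt.comp (f := fun p : ℝ × ℝ => X p.1) (continuousAt_apxResidual hq hpos hderiv) hXfst
  have hexp {Y : ℝ × ℝ → ℝ} (hY : ContinuousAt Y p) :
      ContinuousAt (fun p => Real.exp (Y p ^ q + Y p ^ r - p.1)) p :=
    (((hY.rpow_const (Or.inr (zero_lt_one.trans hq).le)).add
      (hY.rpow_const (Or.inr hr.le))).sub hfst).rexp
  refine ((((hexp hXfst).sub hres).sub (hexp (hXfst.add continuousAt_snd))).div_const 4).add ?_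
  exact ((continuousAt_const.div hfst hτ.ne').add (continuousAt_const.div (hfst.pow 2)
    (pow_pos hτ 2).ne')).mul continuousAt_snd

namespace IsApxSolution

variable {X : ℝ → ℝ} (hX : IsApxSolution q r X)
include hX

theorem isBigO_rpow_tubeExponent (hr : 0 < r) (hrq : r < q) {α : Type*} {l : Filter α}
    {τ f : α → ℝ} (hτ : Tendsto τ l atTop) (hf : f =O[l] (fun i => τ i ^ tubeExponent q r)) :
    f =O[l] (fun i => X (τ i) ^ (r - 2 * q + 1)) :=
  hf.trans ((hX.rpow_isTheta hr hrq _).2.comp_tendsto hτ)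

theorem eventually_tube_pos (hr : 0 < r) (hq : 1 < q) (hrq : r < q) :
    ∀ᶠ τ in atTop, ∀ y, |y| ≤ τ ^ tubeExponent q r → 0 < X τ + y := by
  have hfst := tendsto_fst_tubeFilter (tubeExponent q r)
  refine eventually_tubeFilter.1 (Tendsto.eventually_gt_atTop ?_ 0)
  refine (isEquivalent_of_sub_isBigO_rpow (s := r - 2 * q + 1) (by linarith)
    (hX.tendsto.comp hfst) ?_).tendsto_atTop_iff.2 (hX.tendsto.comp hfst)
  simpa using hX.isBigO_rpow_tubeExponent hr hrq hfst (snd_isBigO_tubeFilter _)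

theorem emdenPerturbationDeriv_isBigO (hq : 1 < q) (hr : 0 < r) (hrq : r < q) :
    (fun p : ℝ × ℝ => emdenPerturbationDeriv q r X p.1 p.2)
      =O[tubeFilter (tubeExponent q r)] (fun p => p.1 ^ (r / q - 2)) := by
  have hq₀ : q ≠ 0 := (zero_lt_one.trans hq).ne'
  have hfst := tendsto_fst_tubeFilter (tubeExponent q r)
  have hlin := (isBigO_linearization_sub hq hr hrq (hX.tendsto.comp hfst)
    (V := fun p => X p.1 + p.2) (by
      simpa using hX.isBigO_rpow_tubeExponent hr hrq hfst (snd_isBigO_tubeFilter _))).trans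
    ((hX.rpow_isTheta hr hrq _).1.comp_tendsto hfst)
  have hsq : (fun p : ℝ × ℝ => 3 / 16 / p.1 ^ 2) =O[tubeFilter (tubeExponent q r)]
      (fun p => p.1 ^ (r / q - 2)) := by
    have hrpow : (fun τ : ℝ => 3 / 16 * τ ^ (-2 : ℝ)) =O[atTop] (fun τ => τ ^ (r / q - 2)) :=
      (isBigO_rpow_rpow_atTop (by linarith [div_pos hr (hr.trans hrq)])).const_mul_left _
    refine (hrpow.comp_tendsto hfst).congr_left fun p => ?_
    simp [Real.rpow_neg_ofNat, div_eq_mul_inv]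
  have hexponent : (r - 2 * q) / q = r / q - 2 := by field_simp
  simp only [Function.comp_def, hexponent] at hlin
  refine (hsq.sub (hlin.const_mul_left (1 / 4))).congr' ?_ EventuallyEq.rfl
  filter_upwards [hfst.eventually hX.apxTime_eq, hfst.eventually_ne_atTop 0] with p htime hτ
  rw [htime, emdenPerturbationDeriv, leadConst]
  field_simp
  ring

theorem exists_abs_emdenPerturbation_sub_le (hq : 1 < q) (hr : 0 < r) (hrq : r < q) :
    ∃ B, ∀ᶠ τ in atTop, ∀ x y, |x| ≤ τ ^ tubeExponent q r → |y| ≤ τ ^ tubeExponent q r →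
      |emdenPerturbation q r X τ x - emdenPerturbation q r X τ y|
        ≤ B * τ ^ (r / q - 2) * |x - y| := by
  obtain ⟨B, hB⟩ := (hX.emdenPerturbationDeriv_isBigO hq hr hrq).bound
  refine ⟨B, ?_⟩
  filter_upwards [(eventually_tubeFilter (P := fun τ y =>
    ‖emdenPerturbationDeriv q r X τ y‖ ≤ B * ‖τ ^ (r / q - 2)‖)).1 hB,
    hX.eventually_tube_pos hr hq hrq, eventually_gt_atTop 0] with τ hbound hpos hτ x y hx hy
  refine (convex_Icc (-τ ^ tubeExponent q r) (τ ^ tubeExponent q r)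
    ).norm_image_sub_le_of_norm_hasDerivWithin_le
    (fun z hz => (hasDerivAt_emdenPerturbation (hpos z (abs_le.2 hz))).hasDerivWithinAt)
    (fun z hz => ?_) (abs_le.1 hy) (abs_le.1 hx)
  simpa [abs_of_pos (Real.rpow_pos_of_pos hτ _)] using hbound z (abs_le.2 hz)

theorem exists_abs_emdenPerturbation_zero_le (hq : 1 < q) (hr : 0 < r) (hrq : r < q) :
    ∃ B, ∀ᶠ τ in atTop, |emdenPerturbation q r X τ 0|
      ≤ B * τ ^ (tubeExponent q r - (2 - r / q)) := by
  have hq₀ : q ≠ 0 := (zero_lt_one.trans hq).ne'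
  obtain ⟨B, hB⟩ := ((((apxResidual_isBigO hq hr hrq).comp_tendsto hX.tendsto).trans
    (hX.rpow_isTheta hr hrq (1 + 2 * r - 4 * q)).1).const_mul_left (-(1 / 4))).bound
  refine ⟨B, ?_⟩
  have hexponent : (1 + 2 * r - 4 * q) / q = tubeExponent q r - (2 - r / q) := by
    unfold tubeExponent
    field_simp
    ring
  filter_upwards [hB, eventually_gt_atTop 0] with τ hτ hpos
  rw [hexponent, Real.norm_of_nonneg (Real.rpow_nonneg hpos.le _)] at hτ
  refine le_of_eq_of_le (congrArg abs ?_) hτ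
  simp only [emdenPerturbation, add_zero, mul_zero, Function.comp_apply]
  ring

theorem exists_isTubePerturbation (hq : 1 < q) (hr : 0 < r) (hrq : r < q) :
    ∃ t₀ B, IsTubePerturbation (emdenPerturbation q r X) t₀ B (tubeExponent q r) (2 - r / q) := by
  obtain ⟨B₁, hB₁⟩ := hX.exists_abs_emdenPerturbation_sub_le hq hr hrq
  obtain ⟨B₀, hB₀⟩ := hX.exists_abs_emdenPerturbation_zero_le hq hr hrq
  obtain ⟨t₀, ht₀⟩ := eventually_atTop.1 (((hB₁.and hB₀).and (eventually_gt_atTop 0)).and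
    (hX.hasDerivAt.and ((hX.tendsto.eventually_gt_atTop 0).and
      (hX.tendsto.eventually (eventually_apxTimeDeriv_pos hr hrq)))))
  have hpos {τ : ℝ} (hτ : t₀ < τ) (e : ℝ) : 0 ≤ τ ^ e := Real.rpow_nonneg (ht₀ τ hτ.le).1.2.le e
  refine ⟨t₀, max B₁ B₀, (ht₀ t₀ le_rfl).1.2, ?_, ?_, ?_⟩
  · rintro p ⟨hp, -⟩
    obtain ⟨⟨-, hτ⟩, hXd, hXpos, hXder⟩ := ht₀ p.1 hp.le
    exact (continuousAt_uncurry_emdenPerturbation hq hr hτ hXd.continuousAt hXpos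
      hXder.ne').continuousWithinAt
  · exact fun τ hτ => (ht₀ τ hτ.le).1.1.2.trans
      (mul_le_mul_of_nonneg_right (le_max_right _ _) (hpos hτ _))
  · intro τ hτ x y hx hy
    rw [neg_sub]
    refine ((ht₀ τ hτ.le).1.1.1 x y hx hy).trans ?_
    have := hpos hτ (r / q - 2)
    gcongr
    exact le_max_left _ _

end IsApxSolution

/-- A positive solution on `(τ₁, ∞)`, tending to infinity, of the equation that `-Δu = f(u)` becomes
for radial `u` in the plane, with `τ = -log |x|²` as independent variable. -/
structure IsEmdenSolution (f : ℝ → ℝ) (τ₁ : ℝ) (v v' : ℝ → ℝ) : Prop where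
  pos : ∀ τ, τ₁ < τ → 0 < v τ
  hasDerivAt : ∀ τ, τ₁ < τ → HasDerivAt v (v' τ) τ
  hasDerivAt_deriv : ∀ τ, τ₁ < τ → HasDerivAt v' (-(Real.exp (-τ) * f (v τ)) / 4) τ
  tendsto : Tendsto v atTop atTop

theorem tubeExponent_lt (hq : 1 < q) (hrq : r < q / 2) :
    tubeExponent q r < 1 / 4 + (1 / 2 - r / q) := by
  have hq₀ : 0 < q := zero_lt_one.trans hq
  rw [tubeExponent, div_lt_iff₀ hq₀, add_mul, sub_mul, div_mul_cancel₀ r hq₀.ne']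
  linarith

theorem exists_isEmdenSolution (hq : 1 < q) (hr : 0 < r) (hrq : r < q / 2) :
    ∃ τ₁ X v v', IsApxSolution q r X ∧
      (fun τ => v τ - X τ) =O[atTop] (fun τ => X τ ^ (r - 2 * q + 1)) ∧
      IsEmdenSolution (fun u => Real.exp (u ^ q + u ^ r)) τ₁ v v' := by
  have hq₀ : 0 < q := zero_lt_one.trans hq
  have hrq' : r < q := by linarith
  obtain ⟨X, hX⟩ := exists_isApxSolution hr hrq'
  obtain ⟨t₀, B, hN⟩ := hX.exists_isTubePerturbation hq hr hrq'
  have hε : 0 < 1 / 2 - r / q := by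
    rw [sub_pos, div_lt_iff₀ hq₀]
    linarith
  have hdecay : 2 - r / q = 1 + 2 * (1 / 4) + (1 / 2 - r / q) := by ring
  rw [hdecay] at hN
  obtain ⟨t₁, -, φ, φ', hφ⟩ := (oscillatorPair (div_pos (sub_pos.2 hq) hq₀)
    ).exists_solution_in_tube hN (tubeExponent_lt hq hrq) hε
  obtain ⟨t₂, ht₂⟩ := eventually_atTop.1 ((hX.hasDerivAt.and
    (hX.hasDerivAt_deriv hq hr hrq')).and (hX.eventually_tube_pos hr hq hrq'))
  have hbound : (fun τ => X τ + φ τ - X τ) =O[atTop] (fun τ => X τ ^ (r - 2 * q + 1)) := by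
    refine hX.isBigO_rpow_tubeExponent hr hrq' tendsto_id (IsBigO.of_bound' ?_)
    filter_upwards [eventually_gt_atTop t₁] with τ hτ
    simpa using (hφ τ hτ).1.trans (le_abs_self _)
  have hv_top : Tendsto (fun τ => X τ + φ τ) atTop atTop :=
    (isEquivalent_of_sub_isBigO_rpow (by linarith) hX.tendsto hbound).tendsto_atTop_iff.2 hX.tendsto
  refine ⟨max t₁ t₂, X, fun τ => X τ + φ τ, fun τ => (apxTimeDeriv q r (X τ))⁻¹ + φ' τ, hX, hbound,
    fun τ hτ => ?_, fun τ hτ => ?_, fun τ hτ => ?_, hv_top⟩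
  all_goals
    obtain ⟨htube, hφd, hφd'⟩ := hφ τ (max_lt_iff.1 hτ).1
    obtain ⟨⟨hXd, hXd'⟩, hpos⟩ := ht₂ τ (max_lt_iff.1 hτ).2.le
  · exact hpos _ htube
  · exact hXd.add hφd
  · refine (hXd'.add hφd').congr_deriv ?_
    rw [← Real.exp_add, neg_add_eq_sub, emdenPerturbation]
    ring

end Existence

section Radial

theorem laplacian_comp_norm_sq {E : Type*} [NormedAddCommGroup E] [InnerProductSpace ℝ E]
    [FiniteDimensional ℝ E] {ψ ψ' : ℝ → ℝ} {ψ'' : ℝ} {x : E}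
    (hψ : ∀ᶠ s in 𝓝 (‖x‖ ^ 2), HasDerivAt ψ (ψ' s) s) (hψ' : HasDerivAt ψ' ψ'' (‖x‖ ^ 2)) :
    Laplacian.laplacian (fun y : E => ψ (‖y‖ ^ 2)) x
      = 4 * ‖x‖ ^ 2 * ψ'' + 2 * Module.finrank ℝ E * ψ' (‖x‖ ^ 2) := by
  have hsq (y : E) : HasFDerivAt (fun y : E => ‖y‖ ^ 2) (2 • innerSL ℝ y) y :=
    (hasStrictFDerivAt_norm_sq y).hasFDerivAt
  have hfderiv : fderiv ℝ (fun y : E => ψ (‖y‖ ^ 2))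
      =ᶠ[𝓝 x] fun y => ψ' (‖y‖ ^ 2) • (2 • innerSL ℝ y) := by
    filter_upwards [(hsq x).continuousAt.eventually hψ] with y hy
    exact (hy.comp_hasFDerivAt y (hsq y)).fderiv
  have hfderiv₂ : HasFDerivAt (fun y : E => ψ' (‖y‖ ^ 2) • (2 • innerSL ℝ y))
      (ψ' (‖x‖ ^ 2) • (2 • innerSL ℝ) + (ψ'' • (2 • innerSL ℝ x)).smulRight (2 • innerSL ℝ x)) x :=
    (hψ'.comp_hasFDerivAt x (hsq x)).smul ((2 • innerSL ℝ : E →L[ℝ] E →L[ℝ] ℝ).hasFDerivAt)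
  have hiterated (e : E) (he : ‖e‖ = 1) : iteratedFDeriv ℝ 2 (fun y : E => ψ (‖y‖ ^ 2)) x ![e, e]
      = 2 * ψ' (‖x‖ ^ 2) + 4 * ψ'' * inner ℝ x e ^ 2 := by
    rw [iteratedFDeriv_two_apply, hfderiv.fderiv_eq, hfderiv₂.fderiv]
    have hinner : innerSL ℝ e e = 1 := by simp [innerSL_apply_apply, he]
    simp [hinner]
    ring
  rw [InnerProductSpace.laplacian_eq_iteratedFDeriv_stdOrthonormalBasis]
  simp only [hiterated _ ((stdOrthonormalBasis ℝ E).norm_eq_one _)]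
  rw [Finset.sum_add_distrib, ← Finset.mul_sum _ _ (4 * ψ''),
    OrthonormalBasis.sum_sq_inner_left]
  simp only [Finset.sum_const, Finset.card_univ, Fintype.card_fin, nsmul_eq_mul]
  ring

theorem contDiffOn_infty_of_second_order {v v' : ℝ → ℝ} {Φ : ℝ × ℝ → ℝ} {U : Set ℝ}
    {S : Set (ℝ × ℝ)} (hU : IsOpen U) (hv : ∀ t ∈ U, HasDerivAt v (v' t) t)
    (hv' : ∀ t ∈ U, HasDerivAt v' (Φ (t, v t)) t) (hS : ∀ t ∈ U, (t, v t) ∈ S)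
    (hΦ : ContDiffOn ℝ ∞ Φ S) : ContDiffOn ℝ ∞ v U := by
  have hfinite (n : ℕ) : ContDiffOn ℝ n v U ∧ ContDiffOn ℝ n v' U := by
    induction n with
    | zero =>
      simp only [Nat.cast_zero, contDiffOn_zero]
      exact ⟨fun t ht => (hv t ht).continuousAt.continuousWithinAt,
        fun t ht => (hv' t ht).continuousAt.continuousWithinAt⟩
    | succ n ih =>
      rw [Nat.cast_succ, contDiffOn_succ_iff_deriv_of_isOpen hU,
        contDiffOn_succ_iff_deriv_of_isOpen hU]
      refine ⟨⟨fun t ht => (hv t ht).differentiableAt.differentiableWithinAt, by simp,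
        ih.2.congr fun t ht => (hv t ht).deriv⟩,
        ⟨fun t ht => (hv' t ht).differentiableAt.differentiableWithinAt, by simp, ?_⟩⟩
      have hcomp : ContDiffOn ℝ n (fun t => Φ (t, v t)) U :=
        (hΦ.of_le (by exact_mod_cast le_top)).comp (contDiffOn_id.prodMk ih.1) hS
      exact hcomp.congr fun t ht => (hv' t ht).deriv
  exact contDiffOn_infty.2 fun n => (hfinite n).1

theorem tendsto_neg_log_norm_sq {E : Type*} [NormedAddCommGroup E] :
    Tendsto (fun x : E => -Real.log (‖x‖ ^ 2)) (𝓝[≠] 0) atTop := by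
  have hnorm : Tendsto (fun x : E => ‖x‖ ^ 2) (𝓝[≠] 0) (𝓝[>] 0) := by
    refine tendsto_nhdsWithin_iff.2 ⟨?_, ?_⟩
    · exact ((continuous_norm.pow 2).tendsto' _ _ (by simp)).mono_left nhdsWithin_le_nhds
    · filter_upwards [self_mem_nhdsWithin] with x hx
      exact pow_pos (norm_pos_iff.2 hx) 2
  exact tendsto_neg_atBot_atTop.comp (Real.tendsto_log_nhdsGT_zero.comp hnorm)

theorem norm_sq_pos_and_lt_of_mem_puncturedDisc {τ₁ : ℝ} {x : Plane}
    (hx : x ∈ puncturedDisc (Real.exp (-τ₁ / 2))) :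
    0 < ‖x‖ ^ 2 ∧ τ₁ < -Real.log (‖x‖ ^ 2) := by
  have hpos : 0 < ‖x‖ := norm_pos_iff.2 hx.2
  have hlog : Real.log ‖x‖ < -τ₁ / 2 :=
    (Real.log_lt_iff_lt_exp hpos).2 (mem_ball_zero_iff.1 hx.1)
  refine ⟨pow_pos hpos 2, ?_⟩
  rw [Real.log_pow]
  push_cast
  linarith

namespace IsEmdenSolution

variable {f v v' : ℝ → ℝ} {τ₁ : ℝ} (hv : IsEmdenSolution f τ₁ v v')
include hv

theorem contDiffOn (hf : ContDiffOn ℝ ∞ f (Set.Ioi 0)) : ContDiffOn ℝ ∞ v (Set.Ioi τ₁) := by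
  refine contDiffOn_infty_of_second_order (S := {p | 0 < p.2})
    (Φ := fun p => -(Real.exp (-p.1) * f p.2) / 4) isOpen_Ioi hv.hasDerivAt hv.hasDerivAt_deriv
    hv.pos ?_
  exact ((contDiff_fst.neg.exp.contDiffOn.mul (hf.comp contDiff_snd.contDiffOn fun p hp => hp)).neg
    ).div_const 4

theorem contDiffOn_radial (hf : ContDiffOn ℝ ∞ f (Set.Ioi 0)) :
    ContDiffOn ℝ ∞ (fun x : Plane => v (-Real.log (‖x‖ ^ 2)))
      (puncturedDisc (Real.exp (-τ₁ / 2))) := by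
  refine (hv.contDiffOn hf).comp (ContDiffOn.neg (ContDiffOn.log ?_ fun x hx => ?_)) fun x hx => ?_
  · exact (contDiff_norm_sq ℝ).contDiffOn
  · exact (norm_sq_pos_and_lt_of_mem_puncturedDisc hx).1.ne'
  · exact (norm_sq_pos_and_lt_of_mem_puncturedDisc hx).2

theorem laplacian_radial {x : Plane} (hx : x ∈ puncturedDisc (Real.exp (-τ₁ / 2))) :
    Laplacian.laplacian (fun x : Plane => v (-Real.log (‖x‖ ^ 2))) x
      = -f (v (-Real.log (‖x‖ ^ 2))) := by
  obtain ⟨hpos, hτ⟩ := norm_sq_pos_and_lt_of_mem_puncturedDisc hx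
  have hlog {s : ℝ} (hs : 0 < s) : HasDerivAt (fun s => -Real.log s) (-s⁻¹) s :=
    (Real.hasDerivAt_log hs.ne').neg
  have hψ : ∀ᶠ s in 𝓝 (‖x‖ ^ 2),
      HasDerivAt (fun s => v (-Real.log s)) (v' (-Real.log s) * -s⁻¹) s := by
    filter_upwards [eventually_gt_nhds hpos,
      (hlog hpos).continuousAt.eventually (eventually_gt_nhds hτ)] with s hs hsτ
    exact (hv.hasDerivAt _ hsτ).comp s (hlog hs)
  have hψ' := ((hv.hasDerivAt_deriv _ hτ).comp (‖x‖ ^ 2) (hlog hpos)).mul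
    (hasDerivAt_inv hpos.ne').fun_neg
  rw [laplacian_comp_norm_sq hψ hψ', neg_neg, Real.exp_log hpos, finrank_euclideanSpace_fin,
    Function.comp_apply]
  have hx₀ : ‖x‖ ≠ 0 := norm_ne_zero_iff.2 hx.2
  field_simp
  push_cast
  ring

theorem isSingularSolution (hf : ContDiffOn ℝ ∞ f (Set.Ioi 0)) :
    IsSingularSolution f (Real.exp (-τ₁ / 2)) (fun x : Plane => v (-Real.log (‖x‖ ^ 2))) where
  contDiffOn := contDiffOn_infty.1 (hv.contDiffOn_radial hf) 2
  nonneg _ hx := (hv.pos _ (norm_sq_pos_and_lt_of_mem_puncturedDisc hx).2).le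
  equation _ hx := by rw [hv.laplacian_radial hx, neg_neg]
  tendsto := hv.tendsto.comp tendsto_neg_log_norm_sq

end IsEmdenSolution

end Radial

section Expansion

section Inversion

variable {a b c : ℝ} {α : Type*} {l : Filter α} {L s V W : α → ℝ}

theorem isBigO_rpow_sub_rpow_of_isEquivalent (p : ℝ) (hL : Tendsto L l atTop) (hV : V ~[l] L)
    (hW : W ~[l] L) :
    (fun i => V i ^ p - W i ^ p) =O[l] (fun i => L i ^ (p - 1) * (V i - W i)) :=
  (isBigO_rpow_sub_rpow p (hW.tendsto_atTop_iff.2 hL) (hV.trans hW.symm)).trans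
    ((isTheta_rpow_of_isEquivalent (p - 1) hL hW).1.mul (isBigO_refl _ _))

theorem isBigO_log_add_const_rpow (ha : 0 < a) (b c : ℝ) :
    (fun x => b * Real.log x + c) =O[atTop] (fun x => x ^ a) :=
  ((isLittleO_log_rpow_atTop ha).isBigO.const_mul_left b).add
    ((isBigO_const_const c one_ne_zero _).trans (isBigO_one_rpow_atTop ha.le))

theorem isBigO_sub_of_add_rpow_isBigO (ha₀ : 0 < a) (ha : a < 1) (hL : Tendsto L l atTop)
    (hs : Tendsto s l atTop) (h : (fun i => s i + s i ^ a - (L i - b * Real.log (L i) - c))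
      =O[l] (fun i => L i ^ (a - 1))) :
    (fun i => s i - L i) =O[l] (fun i => L i ^ a) := by
  have hsum : (fun i => s i + s i ^ a - L i) =O[l] (fun i => L i ^ a) := by
    refine ((h.trans ((isBigO_rpow_rpow_atTop (by linarith)).comp_tendsto hL)).sub
      ((isBigO_log_add_const_rpow ha₀ b c).comp_tendsto hL)).congr_left fun i => ?_
    simp only [Function.comp_apply]
    ring
  have hs_equiv : (fun i => s i + s i ^ a) ~[l] s :=
    isEquivalent_of_sub_isBigO_rpow ha hs (by simpa using isBigO_refl (fun i => s i ^ a) l)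
  have hpow := (isTheta_rpow_of_isEquivalent a hL
    (hs_equiv.symm.trans (isEquivalent_of_sub_isBigO_rpow ha hL hsum))).1
  exact (hsum.sub hpow).congr_left fun i => by ring

/-- Since `a < 1/2`, replacing `s ^ a` by `L ^ a` costs only `O(L ^ (2a - 1)) = O(1)`, so a single
further substitution brings the error down to `O(L ^ (a - 1))`. -/
theorem isBigO_sub_second_iterate (ha₀ : 0 < a) (ha : a < 1 / 2) (hL : Tendsto L l atTop)
    (hs : Tendsto s l atTop) (h : (fun i => s i + s i ^ a - (L i - b * Real.log (L i) - c))
      =O[l] (fun i => L i ^ (a - 1))) :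
    (fun i => s i - (L i - (L i - L i ^ a - b * Real.log (L i)) ^ a - b * Real.log (L i) - c))
      =O[l] (fun i => L i ^ (a - 1)) := by
  have hsL := isBigO_sub_of_add_rpow_isBigO ha₀ (by linarith) hL hs h
  have hs_equiv := isEquivalent_of_sub_isBigO_rpow (by linarith) hL hsL
  have hσ_equiv : (fun i => L i - L i ^ a - b * Real.log (L i)) ~[l] L := by
    refine isEquivalent_of_sub_isBigO_rpow (by linarith : a < 1) hL ?_
    refine ((isBigO_refl (fun i => L i ^ a) l).neg_left.sub
      ((isBigO_log_add_const_rpow ha₀ b 0).comp_tendsto hL)).congr_left fun i => ?_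
    simp only [Function.comp_apply]
    ring
  have hpow : (fun i => s i ^ a - L i ^ a) =O[l] (fun _ => (1 : ℝ)) := by
    simpa [Function.comp_def] using (isBigO_rpow_sub_rpow_of_near a (by linarith) hL hsL).trans
      ((isBigO_rpow_rpow_atTop (p' := 0) (by linarith)).comp_tendsto hL)
  have hone : (fun i => L i ^ (a - 1)) =O[l] (fun _ => (1 : ℝ)) := by
    simpa [Function.comp_def] using
      (isBigO_rpow_rpow_atTop (p' := 0) (by linarith)).comp_tendsto hL
  have hsσ : (fun i => s i - (L i - L i ^ a - b * Real.log (L i))) =O[l] (fun _ => (1 : ℝ)) :=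
    (((h.trans hone).sub hpow).sub (isBigO_const_const c one_ne_zero l)).congr_left fun i => by ring
  have hsσ_pow : (fun i => s i ^ a - (L i - L i ^ a - b * Real.log (L i)) ^ a)
      =O[l] (fun i => L i ^ (a - 1)) := by
    simpa using (isBigO_rpow_sub_rpow_of_isEquivalent a hL hs_equiv hσ_equiv).trans
      ((isBigO_refl _ _).mul hsσ)
  exact (h.sub hsσ_pow).congr_left fun i => by ring

theorem isBigO_rpow_sub_second_iterate (p : ℝ) (ha₀ : 0 < a) (ha : a < 1 / 2)
    (hL : Tendsto L l atTop) (hs : Tendsto s l atTop)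
    (h : (fun i => s i + s i ^ a - (L i - b * Real.log (L i) - c)) =O[l] (fun i => L i ^ (a - 1))) :
    (fun i => s i ^ p
        - (L i - (L i - L i ^ a - b * Real.log (L i)) ^ a - b * Real.log (L i) - c) ^ p)
      =O[l] (fun i => L i ^ (p + a - 2)) := by
  have hsL := isBigO_sub_of_add_rpow_isBigO ha₀ (by linarith) hL hs h
  have hsW := isBigO_sub_second_iterate ha₀ ha hL hs h
  have hWL := (hsL.sub (hsW.trans
    ((isBigO_rpow_rpow_atTop (p' := a) (by linarith)).comp_tendsto hL))).congr_left
      fun i => sub_sub_sub_cancel_left _ _ _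
  refine ((isBigO_rpow_sub_rpow_of_isEquivalent p hL
    (isEquivalent_of_sub_isBigO_rpow (by linarith) hL hsL)
    (isEquivalent_of_sub_isBigO_rpow (by linarith) hL hWL)).trans
    ((isBigO_refl _ _).mul hsW)).trans ?_
  exact (isBigO_rpow_mul_rpow_atTop (by linarith)).comp_tendsto hL

end Inversion

variable {q r : ℝ}

theorem expansion_two (q r L : ℝ) : expansion q r 2 L
    = (L - (L - L ^ (r / q) - (q - 1) / q * Real.log L) ^ (r / q) - (q - 1) / q * Real.log L
      - Real.log q) ^ (1 / q) := by
  simp [expansion, sub_eq_add_neg]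

/-- `-log w` as a function of `τ = -log |x|²`. -/
noncomputable def negLogW (q τ : ℝ) : ℝ := τ - Real.log (τ + 1) - Real.log (q / (q - 1) / 4)

theorem isEquivalent_add_one : (fun τ : ℝ => τ + 1) ~[atTop] (fun τ => τ) :=
  isEquivalent_of_sub_isBigO_rpow zero_lt_one tendsto_id
    (by simpa using isBigO_refl (fun _ : ℝ => (1 : ℝ)) atTop)

theorem isBigO_negLogW_sub {a : ℝ} (ha : 0 < a) (q : ℝ) :
    (fun τ => negLogW q τ - τ) =O[atTop] (fun τ => τ ^ a) := by
  refine (((isBigO_log_add_const_rpow ha (-1) (-Real.log (q / (q - 1) / 4))).comp_tendsto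
    (tendsto_id.atTop_add tendsto_const_nhds)).trans
    (isTheta_rpow_of_isEquivalent a tendsto_id isEquivalent_add_one).1).congr_left fun τ => ?_
  simp only [negLogW, Function.comp_apply, id]
  ring

theorem isEquivalent_negLogW (q : ℝ) : negLogW q ~[atTop] (fun τ => τ) :=
  isEquivalent_of_sub_isBigO_rpow one_half_lt_one tendsto_id (isBigO_negLogW_sub one_half_pos q)

theorem isBigO_negLogW_expansion {a : ℝ} (ha : 0 < a) (hq : 1 < q) :
    (fun τ => negLogW q τ - (q - 1) / q * Real.log (negLogW q τ) - Real.log q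
      - (τ - (2 * q - 1) / q * Real.log τ + Real.log (leadConst q)))
      =O[atTop] (fun τ => τ ^ (a - 1)) := by
  have hlog {V : ℝ → ℝ} (hV : (fun τ => V τ - τ) =O[atTop] (fun τ => τ ^ a))
      (hVτ : V ~[atTop] (fun τ => τ)) :
      (fun τ => Real.log (V τ) - Real.log τ) =O[atTop] (fun τ => τ ^ (a - 1)) := by
    refine (isBigO_log_sub_log tendsto_id hVτ).trans ?_
    refine IsBigO.trans (.mul (.of_bound' ?_) hV)
      (isBigO_rpow_mul_rpow_atTop (p := -1) (by linarith))
    exact Eventually.of_forall fun τ => by rw [Real.rpow_neg_one]; rfl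
  have hlogL := hlog (isBigO_negLogW_sub ha q) (isEquivalent_negLogW q)
  have hlog_add := hlog (by simpa using isBigO_one_rpow_atTop ha.le) isEquivalent_add_one
  have hq₀ : 0 < q := zero_lt_one.trans hq
  have hconst : Real.log (leadConst q) = -Real.log (q / (q - 1) / 4) - Real.log q := by
    have := sub_pos.2 hq
    rw [← Real.log_inv, ← Real.log_div (by positivity) hq₀.ne', leadConst]
    congr 1
    field_simp
  refine (hlog_add.neg_left.sub (hlogL.const_mul_left ((q - 1) / q))).congr_left fun τ => ?_
  have hcoeff : (2 * q - 1) / q = 1 + (q - 1) / q := by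
    field_simp
    ring
  rw [hconst, hcoeff, negLogW]
  ring

theorem isBigO_log_apxTime_sub (hr : 0 < r) (hrq : r < q) :
    (fun x => Real.log (apxTime q r x) - q * Real.log x) =O[atTop] (fun x => x ^ (r - q)) := by
  refine ((isBigO_log_sub_log (tendsto_rpow_atTop (hr.trans hrq))
    (apxTime_isEquivalent hr hrq)).trans ((isBigO_refl _ _).mul
    (apxTime_sub_rpow_isBigO hr hrq))).congr' ?_ ?_
  all_goals filter_upwards [eventually_gt_atTop 0] with x hx
  · rw [Real.log_rpow hx]
  · rw [← Real.rpow_neg hx.le, ← Real.rpow_add hx, neg_add_eq_sub]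

namespace IsApxSolution

variable {X v : ℝ → ℝ} (hX : IsApxSolution q r X)
  (hv : (fun τ => v τ - X τ) =O[atTop] (fun τ => X τ ^ (r - 2 * q + 1)))
include hX hv

theorem isBigO_nonlinearity_sub_log (hr : 0 < r) (hrq : r < q) :
    (fun τ => v τ ^ q + v τ ^ r - (τ - (2 * q - 1) / q * Real.log τ + Real.log (leadConst q)))
      =O[atTop] (fun τ => τ ^ (r / q - 1)) := by
  have hq : q ≠ 0 := (hr.trans hrq).ne'
  have hexponent : (r - q) / q = r / q - 1 := by field_simp
  rw [← hexponent]
  refine IsBigO.trans ?_ (hX.rpow_isTheta hr hrq (r - q)).1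
  refine (((isBigO_nonlinearity_sub hr hrq hX.tendsto hv).sub
    ((isBigO_linear_combination_rpow hr (coeffA q r) (coeffC q)).comp_tendsto hX.tendsto)).add
    (((isBigO_log_apxTime_sub hr hrq).comp_tendsto hX.tendsto).const_mul_left
      ((2 * q - 1) / q))).congr' ?_ EventuallyEq.rfl
  filter_upwards [hX.apxTime_eq] with τ htime
  have htime' := htime
  rw [apxTime] at htime'
  simp only [Function.comp_apply, htime]
  field_simp
  linear_combination -q * htime'

theorem isBigO_sub_expansion (hq : 1 < q) (hr : 0 < r) (hrq : r < q / 2) :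
    (fun τ => v τ - expansion q r 2 (negLogW q τ))
      =O[atTop] (fun τ => negLogW q τ ^ (-(2 - 1 / q - r / q))) := by
  have hq₀ : 0 < q := zero_lt_one.trans hq
  have ha₀ : 0 < r / q := div_pos hr hq₀
  have ha : r / q < 1 / 2 := (div_lt_iff₀ hq₀).2 (by linarith)
  have hv_top : Tendsto v atTop atTop :=
    (isEquivalent_of_sub_isBigO_rpow (by linarith) hX.tendsto hv).tendsto_atTop_iff.2 hX.tendsto
  have hL_equiv := isEquivalent_negLogW q
  have hL : Tendsto (negLogW q) atTop atTop := hL_equiv.tendsto_atTop_iff.2 tendsto_id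
  have hs_top : Tendsto (fun τ => v τ ^ q) atTop atTop := (tendsto_rpow_atTop hq₀).comp hv_top
  have hinv := ((hX.isBigO_nonlinearity_sub_log hv hr (by linarith)).sub
    (isBigO_negLogW_expansion ha₀ hq)).trans
    (isTheta_rpow_of_isEquivalent (r / q - 1) tendsto_id hL_equiv).2
  have hmain := isBigO_rpow_sub_second_iterate (1 / q) ha₀ ha hL hs_top (hinv.congr' (by
    filter_upwards [hv_top.eventually_ge_atTop 0] with τ hτ
    rw [← Real.rpow_mul hτ, mul_div_cancel₀ _ hq₀.ne', sub_sub_sub_cancel_right])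
    EventuallyEq.rfl)
  refine hmain.congr' ?_ (Eventually.of_forall fun τ => ?_)
  · filter_upwards [hv_top.eventually_ge_atTop 0] with τ hτ
    rw [expansion_two, one_div, Real.rpow_rpow_inv hτ hq₀.ne']
  · ring_nf

end IsApxSolution

end Expansion

theorem neg_log_wFun {q : ℝ} (hq : 1 < q) {x : Plane} (hx : x ≠ 0)
    (hx_lt : 0 < -Real.log (‖x‖ ^ 2)) :
    -Real.log (wFun q x) = negLogW q (-Real.log (‖x‖ ^ 2)) := by
  have := sub_pos.2 hq
  have : 0 < ‖x‖ := norm_pos_iff.2 hx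
  rw [wFun, negLogW, one_div, Real.log_inv, Real.log_mul (by positivity) (by positivity),
    Real.log_mul (by positivity) (by positivity)]
  ring

theorem eventuallyEq_neg_log_wFun {q : ℝ} (hq : 1 < q) :
    (fun x : Plane => negLogW q (-Real.log (‖x‖ ^ 2)))
      =ᶠ[𝓝[≠] 0] (fun x => -Real.log (wFun q x)) := by
  filter_upwards [self_mem_nhdsWithin, tendsto_neg_log_norm_sq.eventually_gt_atTop 0]
    with x hx hx_lt
  exact (neg_log_wFun hq hx hx_lt).symm

theorem contDiffOn_exp_rpow_add_rpow (q r : ℝ) :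
    ContDiffOn ℝ ∞ (fun s : ℝ => Real.exp (s ^ q + s ^ r)) (Set.Ioi 0) :=
  ((contDiffOn_id.rpow_const_of_ne fun _ hs => ne_of_gt hs).add
    (contDiffOn_id.rpow_const_of_ne fun _ hs => ne_of_gt hs)).exp

theorem mainTheorem4 (q r : ℝ) (hq : 1 < q) (hr : 0 < r) (hrq : r < q / 2) :
    ∃ R : ℝ, 0 < R ∧ ∃ u : Plane → ℝ,
      IsSingularSolution (fun s : ℝ => Real.exp (s ^ q + s ^ r)) R u ∧
      ContDiffOn ℝ ∞ u (puncturedDisc R) ∧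
      (∀ x ∈ puncturedDisc R, ∀ y ∈ puncturedDisc R, ‖x‖ = ‖y‖ → u x = u y) ∧
      ∃ n : ℕ, 2 ≤ n ∧ 1 / (1 - r / q) < (n : ℝ) ∧ (n : ℝ) ≤ 1 / (1 - r / q) + 1 ∧
        (fun x : Plane => u x - expansion q r n (-Real.log (wFun q x)))
          =O[𝓝[≠] (0 : Plane)]
        (fun x : Plane => (-Real.log (wFun q x)) ^ (-(2 - 1 / q - r / q))) := by
  obtain ⟨τ₁, X, v, v', hX, hvX, hv⟩ := exists_isEmdenSolution hq hr hrq
  have hf := contDiffOn_exp_rpow_add_rpow q r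
  have ha₀ : 0 < r / q := by positivity
  have ha : r / q < 1 / 2 := (div_lt_iff₀ (by positivity)).2 (by linarith)
  refine ⟨Real.exp (-τ₁ / 2), Real.exp_pos _, fun x => v (-Real.log (‖x‖ ^ 2)),
    hv.isSingularSolution hf, hv.contDiffOn_radial hf, fun x _ y _ hxy => by simp only [hxy],
    2, le_rfl, ?_, ?_, ?_⟩
  · exact (div_lt_iff₀ (by linarith)).2 (by push_cast; linarith)
  · have : 1 ≤ 1 / (1 - r / q) := (le_div_iff₀ (by linarith)).2 (by linarith)
    push_cast
    linarith
  · have hw := eventuallyEq_neg_log_wFun hq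
    refine ((hX.isBigO_sub_expansion hvX hq hr hrq).comp_tendsto tendsto_neg_log_norm_sq).congr'
      ?_ ?_
    all_goals filter_upwards [hw] with x hx
    all_goals simp only [Function.comp_apply, hx]
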